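/- Let $p$ be a prime, $m\ge 1$ and $s\ge 1$ integers, and $N=p^m$. Let $1\ge\gamma_1\ge\gamma_2\ge\cdots$ be positive real numbers, let $\gamma_{\mathfrak u}=\prod_{j\in\mathfrak u}\gamma_j$ for $\mathfrak u\subseteq[s]=\{1,\dots,s\}$, and let $0=w_1\le w_2\le\cdots$ be integers. *Discrepancy.* For points $\mathcal P=(\boldsymbol x_0,\dots,\boldsymbol x_{N-1})$ in $[0,1)^s$ and $\boldsymbol t\in(0,1]^s$ put $\Delta(\boldsymbol t,\mathcal P)=\frac1N\#\{n:\boldsymbol x_n\in\prod_j[0,t_j)\}-\prod_j t_j$. The weighted star discrepancy is $$D^*_{N,\gamma}(\mathcal P)=\sup_{\boldsymbol t\in(0,1]^s}\max_{\emptyset\ne\mathfrak u\subseteq[s]}\gamma_{\mathfrak u}|\Delta((\boldsymbol t_{\mathfrak u},\boldsymbol 1),\mathcal P)|,$$ where $(\boldsymbol t_{\mathfrak u},\boldsymbol 1)$ has $j$-th coordinate $t_j$ if $j\in\mathfrak u$ and $1$ otherwise. *Polynomial lattice points.* Identify $\mathbb F_p$ with $\{0,\dots,p-1\}$ and define $\phi_m:\mathbb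 F_p((x^{-1}))\to[0,1)$ by $\phi_m(\sum_l t_lx^{-l})=\sum_{l=1}^m t_lp^{-l}$. For $0\le n<p^m$ with base-$p$ digits $n_0,\dots,n_{m-1}$ let $n(x)=\sum_{r<m}n_rx^r$. For $f\in\mathbb F_p[x]$ of degree $m$ and $\boldsymbol g\in\mathbb F_p[x]^s$, $\mathcal P(\boldsymbol g,f)$ consists of the points $\boldsymbol x_n=(\phi_m(n g_1/f),\dots,\phi_m(n g_s/f))$, $0\le n<p^m$; write $D^*_{N,\gamma}(\boldsymbol g,f)$ for its weighted star discrepancy. *Reduced component-by-component construction, for the modulus $f=x^m$.* Let $G_{p,m}$ be the set of polynomials over $\mathbb F_p$ of degree $<m$. Let $\mathcal G_{p,m-w}$ be the set of $g\in\mathbb F_p[x]$ with $\deg g<m-w$ and $\gcd(g,x^m)=1$ if $w<m$, and $\{1\}$ if $w\ge m$. For $0\neq h\in G_{p,m}$ of degree $a$ with leading coefficient $h_a$ put $r_p(h)=p^{-a-1}\sin^{-2}(\pi h_a/p)$; put $r_p(0,\gamma)=1+\gamma$ and $r_p(h,\gamma)=\gamma r_p(h)$ for $h\ne0$. For $\boldsymbol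 g\in\mathbb F_p[x]^d$ let $$R^d_\gamma(\boldsymbol g)=\sum_{\boldsymbol h}\prod_{i=1}^d r_p(h_i,\gamma_i),$$ the sum being over all $\boldsymbol h\in G_{p,m}^d\setminus\{\boldsymbol 0\}$ with $h_1g_1+\dots+h_dg_d\equiv0\pmod{x^m}$. Suppose that $g_1=1$ and that, for $d=1,\dots,s-1$, $g_{d+1}$ is an element of $\mathcal G_{p,m-w_{d+1}}$ that minimizes $g\mapsto R^{d+1}_\gamma(x^{w_1}g_1,\dots,x^{w_d}g_d,x^{w_{d+1}}g)$ over $\mathcal G_{p,m-w_{d+1}}$. *Claim.* $$D^*_{N,\gamma}\big((x^{w_1}g_1,\dots,x^{w_s}g_s),x^m\big)\le\sum_{\emptyset\ne\mathfrak u\subseteq[s]}\gamma_{\mathfrak u}\Big(1-\Big(1-\frac1N\Big)^{|\mathfrak u|}\Big)+\frac1N\prod_{i=1}^s\Big(1+\gamma_i+2\gamma_i\,p^{\min\{w_i,m\}}\,m\,\frac{p^2-1}{3p}\Big).$$ -/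

import Mathlib

namespace PolyLattice

noncomputable section

open Polynomial

/-! ### Weighted star discrepancy

Coordinates are indexed by `Fin s = {0, …, s-1}`, and sequences `(a_j)_{j ≥ 1}` by `ℕ` starting
at `0`: the Lean value `a j` is the `(j+1)`-st member of the sequence. -/

/-- Local discrepancy `Δ(t, P)` of the points `x_0, …, x_{N-1}` (counted with multiplicity). -/
def localDiscrepancy {N s : ℕ} (x : Fin N → Fin s → ℝ) (t : Fin s → ℝ) : ℝ :=
  (1 / (N : ℝ)) * ∑ n, Set.indicator {y : Fin s → ℝ | ∀ j, 0 ≤ y j ∧ y j < t j} (fun _ => (1 : ℝ)) (x n)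
    - ∏ j, t j

/-- The vector `(t_u, 1)`: `t_j` for `j ∈ u` and `1` otherwise. -/
def fillOnes {s : ℕ} (u : Finset (Fin s)) (t : Fin s → ℝ) : Fin s → ℝ :=
  fun j => if j ∈ u then t j else 1

/-- The values `γ_u |Δ((t_u, 1), P)|` for `t ∈ (0,1]^s` and nonempty `u`. -/
def weightedLocalValues {N s : ℕ} (γ : Finset (Fin s) → ℝ) (x : Fin N → Fin s → ℝ) : Set ℝ :=
  {v | ∃ t : Fin s → ℝ, (∀ j, 0 < t j ∧ t j ≤ 1) ∧ ∃ u : Finset (Fin s), u.Nonempty ∧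
    v = γ u * |localDiscrepancy x (fillOnes u t)|}

/-- Weighted star discrepancy: the supremum over `t ∈ (0,1]^s` of the maximum over nonempty `u`
of `γ_u |Δ((t_u, 1), P)|`. -/
def weightedStarDiscrepancy {N s : ℕ} (γ : Finset (Fin s) → ℝ) (x : Fin N → Fin s → ℝ) : ℝ :=
  sSup (weightedLocalValues γ x)

/-- Product weights `γ_u = ∏_{j ∈ u} γ_j`. -/
def productWeight {s : ℕ} (γ : ℕ → ℝ) (u : Finset (Fin s)) : ℝ :=
  ∏ j ∈ u, γ j

lemma abs_localDiscrepancy_le {N s : ℕ} (x : Fin N → Fin s → ℝ) (t : Fin s → ℝ)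
    (ht : ∀ j, 0 < t j ∧ t j ≤ 1) : |localDiscrepancy x t| ≤ 1 := by
  have h1 : 0 ≤ ∏ j, t j := Finset.prod_nonneg fun j _ => (ht j).1.le
  have h2 : ∏ j, t j ≤ 1 := Finset.prod_le_one (fun j _ => (ht j).1.le) fun j _ => (ht j).2
  set S : ℝ := ∑ n, Set.indicator {y : Fin s → ℝ | ∀ j, 0 ≤ y j ∧ y j < t j}
    (fun _ => (1 : ℝ)) (x n) with hS
  have h3 : 0 ≤ S := Finset.sum_nonneg fun n _ => Set.indicator_nonneg (fun _ _ => zero_le_one) _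
  have h4 : S ≤ N := by
    have : S ≤ ∑ _n : Fin N, (1 : ℝ) :=
      Finset.sum_le_sum fun n _ => Set.indicator_le_self' (fun _ _ => zero_le_one) _
    simpa using this
  have h5 : 0 ≤ (1 / (N : ℝ)) * S := by positivity
  have h6 : (1 / (N : ℝ)) * S ≤ 1 := by
    rw [one_div, inv_mul_eq_div]
    exact div_le_one_of_le₀ h4 (Nat.cast_nonneg N)
  have h7 : localDiscrepancy x t = (1 / (N : ℝ)) * S - ∏ j, t j := rfl
  rw [h7, abs_le]
  constructor <;> linarith

/-- The supremum that defines the weighted star discrepancy is always finite. -/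
lemma bddAbove_weightedLocalValues {N s : ℕ} (γ : Finset (Fin s) → ℝ) (x : Fin N → Fin s → ℝ) :
    BddAbove (weightedLocalValues γ x) := by
  refine ⟨∑ u, |γ u|, ?_⟩
  rintro v ⟨t, ht, u, -, rfl⟩
  have h : |localDiscrepancy x (fillOnes u t)| ≤ 1 := by
    refine abs_localDiscrepancy_le x _ fun j => ?_
    unfold fillOnes
    split_ifs
    · exact ht j
    · norm_num
  calc γ u * |localDiscrepancy x (fillOnes u t)|
      ≤ |γ u| * 1 := mul_le_mul (le_abs_self _) h (abs_nonneg _) (abs_nonneg _)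
    _ = |γ u| := mul_one _
    _ ≤ ∑ u, |γ u| :=
        Finset.single_le_sum (f := fun u => |γ u|) (fun _ _ => abs_nonneg _) (Finset.mem_univ u)

/-! ### Polynomial lattice point sets -/

section

variable (p : ℕ) [Fact p.Prime]

/-- The embedding `F_p[x] → F_p((x⁻¹))`. The field `F_p((x⁻¹))` is the Laurent series field in the
variable `x⁻¹`, so the coefficient at index `l` belongs to `x^{-l}`, and the polynomial variable
is sent to the series with the single coefficient `1` at index `-1`. -/
def laurentAtInfty : (ZMod p)[X] →ₐ[ZMod p] LaurentSeries (ZMod p) :=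
  aeval (HahnSeries.single (-1 : ℤ) (1 : ZMod p) : LaurentSeries (ZMod p))

/-- `φ_m (∑_l t_l x^{-l}) = ∑_{l=1}^m t_l p^{-l}`, where `t_l ∈ {0, …, p-1}`. -/
def phi (m : ℕ) (L : LaurentSeries (ZMod p)) : ℝ :=
  ∑ l ∈ Finset.Icc 1 m, ((L.coeff (l : ℤ)).val : ℝ) / (p : ℝ) ^ l

/-- The polynomial `n(x) = ∑_{r<m} n_r x^r`, with `n_r` the base-`p` digits of `n`. -/
def digitPoly (m n : ℕ) : (ZMod p)[X] :=
  ∑ r ∈ Finset.range m, C ((n / p ^ r % p : ℕ) : ZMod p) * X ^ r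

/-- The polynomial lattice point set `P(g, f)`, with `deg f = m`: the points
`x_n = (φ_m(n g_1 / f), …, φ_m(n g_s / f))` for `0 ≤ n < p^m`. -/
def latticePoints (m : ℕ) {s : ℕ} (g : Fin s → (ZMod p)[X]) (f : (ZMod p)[X]) :
    Fin (p ^ m) → Fin s → ℝ :=
  fun n i => phi p m (laurentAtInfty p (digitPoly p m n * g i) / laurentAtInfty p f)

/-! ### The reduced component-by-component construction -/

lemma finite_degree_lt (m : ℕ) : {h : (ZMod p)[X] | h.degree < m}.Finite := by
  have e := (Polynomial.degreeLTEquiv (ZMod p) m).toEquiv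
  have : Finite (Polynomial.degreeLT (ZMod p) m) := Finite.of_equiv _ e.symm
  refine Set.Finite.subset (Set.toFinite ((Polynomial.degreeLT (ZMod p) m : Set (ZMod p)[X]))) ?_
  intro h hh
  exact Polynomial.mem_degreeLT.2 hh

/-- `G_{p,m}`: the polynomials over `F_p` of degree `< m` (the zero polynomial included). -/
def polysLT (m : ℕ) : Finset (ZMod p)[X] := (finite_degree_lt p m).toFinset

/-- The search set: the `g` with `deg g < m - w` and `gcd(g, f) = 1` if `w < m`, and `{1}` if
`w ≥ m`. -/
def searchSet (m w : ℕ) (f : (ZMod p)[X]) : Set (ZMod p)[X] :=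
  if w < m then {g | g ∈ polysLT p (m - w) ∧ IsCoprime g f} else {1}

/-- `r_p(h) = 1 / (p^{a+1} sin²(π h_a / p))` for `h ≠ 0` of degree `a` with leading
coefficient `h_a ∈ {1, …, p-1}`. -/
def rp (h : (ZMod p)[X]) : ℝ :=
  1 / ((p : ℝ) ^ (h.natDegree + 1) * Real.sin (Real.pi / p * (h.leadingCoeff.val : ℝ)) ^ 2)

open Classical in
/-- `r_p(h, γ)`, equal to `1 + γ` for `h = 0` and to `γ r_p(h)` otherwise. -/
def rpWeighted (h : (ZMod p)[X]) (γ : ℝ) : ℝ :=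
  if h = 0 then 1 + γ else γ * rp p h

open Classical in
/-- The quantity `R^d_γ(g, f)`: the sum of `∏_i r_p(h_i, γ_i)` over all nonzero `h ∈ G_{p,m}^d`
with `h · g ≡ 0 (mod f)`. -/
def figureR (m : ℕ) (γ : ℕ → ℝ) {d : ℕ} (g : Fin d → (ZMod p)[X]) (f : (ZMod p)[X]) : ℝ :=
  ∑ h ∈ (Fintype.piFinset fun _ : Fin d => polysLT p m) with h ≠ 0 ∧ f ∣ ∑ i, h i * g i,
    ∏ i, rpWeighted p (h i) (γ i)

/-- The generating vector `(x^{w_1} g_1, …, x^{w_s} g_s)`. -/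
def shiftedVector (w : ℕ → ℕ) {s : ℕ} (g : Fin s → (ZMod p)[X]) : Fin s → (ZMod p)[X] :=
  fun i : Fin s => X ^ w (i : ℕ) * g i

/-- `(g_1, …, g_s)` is a possible output of the reduced component-by-component algorithm: each
component lies in its search set, the first one is `1`, and each later one minimizes `R` of the
vector formed by the previous components and itself, over its search set. -/
structure IsReducedCBC (m : ℕ) (f : (ZMod p)[X]) (w : ℕ → ℕ) (γ : ℕ → ℝ) {s : ℕ}
    (g : Fin s → (ZMod p)[X]) : Prop where
  mem_searchSet : ∀ i : Fin s, g i ∈ searchSet p m (w i) f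
  first_eq_one : ∀ i : Fin s, (i : ℕ) = 0 → g i = 1
  minimal : ∀ (d : ℕ) (hd : d < s), 1 ≤ d → ∀ q ∈ searchSet p m (w d) f,
    figureR p m γ (Fin.take (d + 1) hd (shiftedVector p w g)) f ≤
      figureR p m γ (Fin.take (d + 1) hd (shiftedVector p w (Function.update g ⟨d, hd⟩ q))) f

end

end

end PolyLattice

namespace PolyLattice

noncomputable section

open Polynomial

/-! ### A cosecant sum -/

/-! All points lie on the grid of mesh `p^{-m}`, so rounding the corner of a box up to the grid
changes its volume but not its points. The change of volume costs at most `1 - (1 - 1/N)^|u|`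
(`prod_sub_prod_le`), which gives the first sum in the bound.

For a box with corner on the grid, the indicator is a product of functions of digit vectors, each
expanded in additive characters. Averaging over the lattice keeps exactly the frequencies `h` with
`∑ h_j G_j ≡ 0 (mod x^m)` (`mean_prod_eq_sum_dual`). The frequency `0` contributes the volume, and
the other coefficients are bounded by `r_p` (`norm_box_sum_le`), so the weighted grid discrepancy is
at most `R`, uniformly in `u` and the box.

It remains to bound `R` for the constructed vector, by induction on the dimension. Splitting off the
last coordinate (`figureR_snoc`) leaves `(1 + γ) R` of the shorter vector plus a sum over solutions
of `c + b x^w q ≡ 0`. A minimizer does no worse than the average over `q`, and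
`sum_searchFinset_sum_rp_le` bounds that average by `2 p^{min(w,m)} T / p^m`, where `T = ∑ r_p = m
(p² - 1)/(3p)`. The value of `T` rests on the cosecant sum, and the factor `2` on the search set
holding at least half of the polynomials of degree `< m - w`. -/

lemma sum_zmod_val {M : Type*} [AddCommMonoid M] (n : ℕ) [NeZero n] (F : ℕ → M) :
    ∑ j : ZMod n, F j.val = ∑ j ∈ Finset.range n, F j := by
  cases n with
  | zero => exact absurd rfl (NeZero.ne 0)
  | succ k => exact Fin.sum_univ_eq_sum_range F (k + 1)

/-- At an `n`-th root of unity `z ≠ 1` the geometric sum vanishes and only `n` survives on the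
right. -/
lemma sub_one_mul_sum_mul_pow (z : ℂ) (n : ℕ) :
    (z - 1) * ∑ j ∈ Finset.range n, (j : ℂ) * z ^ j
      = n * z ^ n - z * ∑ j ∈ Finset.range n, z ^ j := by
  induction n with
  | zero => simp
  | succ k ih =>
    rw [Finset.sum_range_succ, Finset.sum_range_succ, mul_add, mul_add, ih]
    push_cast
    ring

lemma stdAddChar_eq_pow (n : ℕ) [NeZero n] (j k : ZMod n) :
    ZMod.stdAddChar (j * k) = (ZMod.stdAddChar k : ℂ) ^ j.val := by
  rw [← AddChar.map_nsmul_eq_pow]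
  congr 1
  simp

lemma norm_stdAddChar_sub_one (n : ℕ) [NeZero n] (k : ZMod n) :
    ‖(ZMod.stdAddChar k : ℂ) - 1‖ = |2 * Real.sin (Real.pi / n * k.val)| := by
  have h : (ZMod.stdAddChar k : ℂ) = Complex.exp (Complex.I * ((2 * (Real.pi / n * k.val) : ℝ) : ℂ)) := by
    conv_lhs => rw [← ZMod.natCast_zmod_val k]
    have := ZMod.stdAddChar_coe (N := n) (k.val : ℤ)
    rw [Int.cast_natCast] at this
    rw [this]
    congr 1
    push_cast
    ring
  rw [h, Complex.norm_exp_I_mul_ofReal_sub_one, Real.norm_eq_abs]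
  congr 3
  ring

lemma sum_val_mul_stdAddChar (n : ℕ) [NeZero n] (k : ZMod n) (hk : k ≠ 0) :
    ((ZMod.stdAddChar k : ℂ) - 1) * ∑ j : ZMod n, (j.val : ℂ) * ZMod.stdAddChar (j * k) = n := by
  set z : ℂ := ZMod.stdAddChar k with hz
  have hz1 : z ≠ 1 := by
    intro h
    apply hk
    apply ZMod.injective_stdAddChar
    rw [← hz, h, AddChar.map_zero_eq_one]
  have hzn : z ^ n = 1 := by
    rw [hz, ← AddChar.map_nsmul_eq_pow]
    simp
  have hg : ∑ j ∈ Finset.range n, z ^ j = 0 := by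
    rw [geom_sum_eq hz1, hzn]; simp
  simp_rw [stdAddChar_eq_pow, ← hz]
  rw [sum_zmod_val n (fun j => (j : ℂ) * z ^ j), sub_one_mul_sum_mul_pow, hzn, hg]
  simp

/-- Parseval on `ZMod n` for the function `j ↦ j`, whose transform away from `0` has modulus `n / (2
|sin(πk/n)|)`. -/
lemma sum_norm_sq_val_transform (n : ℕ) [NeZero n] :
    ∑ k : ZMod n, ‖∑ j : ZMod n, (j.val : ℂ) * ZMod.stdAddChar (j * k)‖ ^ 2
      = n * ∑ j ∈ Finset.range n, (j : ℝ) ^ 2 := by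
  have key : ((∑ k : ZMod n, ‖∑ j : ZMod n, (j.val : ℂ) * ZMod.stdAddChar (j * k)‖ ^ 2 : ℝ) : ℂ)
      = n * ∑ j : ZMod n, (j.val : ℂ) ^ 2 := by
    push_cast
    simp_rw [← Complex.mul_conj', map_sum, map_mul, Complex.conj_natCast, ← AddChar.map_neg_eq_conj,
      Finset.sum_mul_sum]
    rw [Finset.sum_comm, Finset.mul_sum]
    refine Finset.sum_congr rfl fun i _ => ?_
    rw [Finset.sum_comm]
    have h : ∀ j : ZMod n, ∑ k : ZMod n, (i.val : ℂ) * ZMod.stdAddChar (i * k) *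
        ((j.val : ℂ) * ZMod.stdAddChar (-(j * k))) = if i = j then (n : ℂ) * (i.val : ℂ) ^ 2 else 0 := by
      intro j
      have h1 : ∀ k : ZMod n, (i.val : ℂ) * ZMod.stdAddChar (i * k) *
        ((j.val : ℂ) * ZMod.stdAddChar (-(j * k)))
          = (i.val : ℂ) * j.val * ZMod.stdAddChar (k * (i - j)) := by
        intro k
        have : k * (i - j) = i * k + -(j * k) := by ring
        rw [this, AddChar.map_add_eq_mul]
        ring
      simp_rw [h1]
      rw [← Finset.mul_sum, AddChar.sum_mulShift _ (ZMod.isPrimitive_stdAddChar n)]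
      by_cases hij : i = j
      · subst hij; simp [ZMod.card]; ring
      · simp [hij, sub_eq_zero]
    simp_rw [h]
    simp
  rw [sum_zmod_val n (fun j => (j : ℂ) ^ 2)] at key
  exact_mod_cast key

lemma sum_range_sq_real (n : ℕ) :
    ∑ j ∈ Finset.range n, (j : ℝ) ^ 2 = n * (n - 1) * (2 * n - 1) / 6 := by
  induction n with
  | zero => simp
  | succ k ih => rw [Finset.sum_range_succ, ih]; push_cast; ring

lemma sum_range_real (n : ℕ) : ∑ j ∈ Finset.range n, (j : ℝ) = n * (n - 1) / 2 := by
  induction n with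
  | zero => simp
  | succ k ih => rw [Finset.sum_range_succ, ih]; push_cast; ring

/-- `∑_{k=1}^{n-1} 1 / sin²(πk/n) = (n² - 1) / 3`. -/
lemma sum_one_div_sin_sq (n : ℕ) [NeZero n] :
    ∑ k ∈ (Finset.univ : Finset (ZMod n)).erase 0, 1 / Real.sin (Real.pi / n * k.val) ^ 2
      = ((n : ℝ) ^ 2 - 1) / 3 := by
  have hn : (n : ℝ) ≠ 0 := Nat.cast_ne_zero.2 (NeZero.ne n)
  have h1 := sum_norm_sq_val_transform n
  -- In Parseval's identity the frequency `0` gives `(n(n-1)/2)²` and every other one `n²/4` times a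
  -- squared cosecant; solving for the cosecant sum finishes the proof.
  rw [← Finset.add_sum_erase _ _ (Finset.mem_univ (0 : ZMod n)), sum_range_sq_real] at h1
  have h0 : ‖∑ j : ZMod n, (j.val : ℂ) * ZMod.stdAddChar (j * 0)‖ = n * (n - 1) / 2 := by
    simp only [mul_zero, AddChar.map_zero_eq_one, mul_one]
    rw [sum_zmod_val n (fun j => (j : ℂ)), ← sum_range_real]
    have : (∑ j ∈ Finset.range n, (j : ℂ)) = ((∑ j ∈ Finset.range n, j : ℕ) : ℂ) := by push_cast; rfl
    rw [this, Complex.norm_natCast]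
    push_cast; rfl
  have h2 : ∀ k ∈ (Finset.univ : Finset (ZMod n)).erase 0,
      ‖∑ j : ZMod n, (j.val : ℂ) * ZMod.stdAddChar (j * k)‖ ^ 2
        = (n : ℝ) ^ 2 / 4 * (1 / Real.sin (Real.pi / n * k.val) ^ 2) := by
    intro k hk
    have h3 := congrArg norm (sum_val_mul_stdAddChar n k (Finset.ne_of_mem_erase hk))
    rw [norm_mul, norm_stdAddChar_sub_one, Complex.norm_natCast] at h3
    have h4 := congrArg (· ^ 2) h3
    simp only [mul_pow, sq_abs] at h4
    have hs : Real.sin (Real.pi / n * k.val) ^ 2 ≠ 0 := by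
      intro h
      rw [h] at h4
      simp at h4
      exact NeZero.ne n (pow_eq_zero_iff two_ne_zero |>.1 (by exact_mod_cast h4.symm))
    rw [mul_one_div, eq_div_iff hs]
    linarith
  rw [h0, Finset.sum_congr rfl h2, ← Finset.mul_sum] at h1
  have h5 : (n : ℝ) ^ 2 ≠ 0 := pow_ne_zero 2 hn
  apply mul_left_cancel₀ h5
  linarith

/-! ### Polynomials of bounded degree as coefficient vectors -/

section

set_option linter.unusedSectionVars false

variable (p : ℕ) [Fact p.Prime]

/-- The polynomial of degree `< m` with the given coefficients. -/
def polyOf {m : ℕ} (v : Fin m → ZMod p) : (ZMod p)[X] := ∑ i, C (v i) * X ^ (i : ℕ)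

lemma coeff_polyOf {m : ℕ} (v : Fin m → ZMod p) (i : Fin m) : (polyOf p v).coeff i = v i := by
  simp only [polyOf, finsetSum_coeff, coeff_C_mul, coeff_X_pow, Fin.val_inj]
  simp

lemma degree_polyOf_lt {m : ℕ} (v : Fin m → ZMod p) : (polyOf p v).degree < m := by
  rw [degree_lt_iff_coeff_zero]
  intro k hk
  simp only [polyOf, finsetSum_coeff, coeff_C_mul, coeff_X_pow]
  refine Finset.sum_eq_zero fun i _ => ?_
  rw [if_neg (by have := i.isLt; omega), mul_zero]

lemma polyOf_injective (m : ℕ) : Function.Injective (polyOf p (m := m)) := by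
  intro v w h
  funext i
  rw [← coeff_polyOf p v, h, coeff_polyOf]

lemma polyOf_coeff {m : ℕ} {h : (ZMod p)[X]} (hh : h.degree < m) :
    polyOf p (fun i : Fin m => h.coeff i) = h := by
  ext k
  by_cases hk : k < m
  · exact coeff_polyOf p (fun i : Fin m => h.coeff i) ⟨k, hk⟩
  · rw [(degree_lt_iff_coeff_zero _ _).1 (degree_polyOf_lt p _) k (by omega),
      (degree_lt_iff_coeff_zero _ _).1 hh k (by omega)]

@[simp] lemma polyOf_zero (m : ℕ) : polyOf p (0 : Fin m → ZMod p) = 0 := by simp [polyOf]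

lemma polyOf_eq_zero_iff {m : ℕ} (v : Fin m → ZMod p) : polyOf p v = 0 ↔ v = 0 := by
  rw [← polyOf_zero p m, (polyOf_injective p m).eq_iff]

lemma mem_polysLT {m : ℕ} {h : (ZMod p)[X]} : h ∈ polysLT p m ↔ h.degree < m := by
  simp [polysLT]

lemma sum_polysLT {M : Type*} [AddCommMonoid M] (m : ℕ) (F : (ZMod p)[X] → M) :
    ∑ h ∈ polysLT p m, F h = ∑ v : Fin m → ZMod p, F (polyOf p v) := by
  symm
  refine Finset.sum_nbij (polyOf p) (fun v _ => (mem_polysLT p).2 (degree_polyOf_lt p v))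
    (polyOf_injective p m).injOn (fun h hh => ?_) (fun _ _ => rfl)
  exact ⟨fun i => h.coeff i, by simp, polyOf_coeff p ((mem_polysLT p).1 hh)⟩

lemma card_polysLT (m : ℕ) : (polysLT p m).card = p ^ m := by
  rw [Finset.card_eq_sum_ones, sum_polysLT]
  simp [ZMod.card]

lemma polyOf_cons {m : ℕ} (b : ZMod p) (v : Fin m → ZMod p) :
    polyOf p (Fin.cons b v : Fin (m + 1) → ZMod p) = X * polyOf p v + C b := by
  simp only [polyOf, Fin.sum_univ_succ, Fin.cons_zero, Fin.cons_succ, Fin.val_zero, pow_zero,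
    mul_one, Fin.val_succ, Finset.mul_sum]
  rw [add_comm]
  congr 1
  refine Finset.sum_congr rfl fun i _ => ?_
  ring

lemma polyOf_snoc {m : ℕ} (v : Fin m → ZMod p) (b : ZMod p) :
    polyOf p (Fin.snoc v b : Fin (m + 1) → ZMod p) = polyOf p v + C b * X ^ m := by
  simp [polyOf, Fin.sum_univ_castSucc]

lemma sum_cons {M α : Type*} [AddCommMonoid M] [Fintype α] {m : ℕ} (F : (Fin (m + 1) → α) → M) :
    ∑ v, F v = ∑ b : α, ∑ v : Fin m → α, F (Fin.cons b v) := by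
  rw [← Fintype.sum_prod_type', ← (Fin.consEquiv fun _ => α).sum_comp]
  rfl

lemma sum_snoc {M α : Type*} [AddCommMonoid M] [Fintype α] {m : ℕ} (F : (Fin (m + 1) → α) → M) :
    ∑ v, F v = ∑ b : α, ∑ v : Fin m → α, F (Fin.snoc v b) := by
  rw [← Fintype.sum_prod_type', ← (Fin.snocEquiv fun _ => α).sum_comp]
  rfl

lemma rp_nonneg (h : (ZMod p)[X]) : 0 ≤ rp p h := by
  unfold rp; positivity

/-- Only degree and leading coefficient enter `rp`, so a new lowest coefficient just costs a factor
`p`; this drives the induction in `norm_box_sum_le`. -/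
lemma rp_X_mul_add_C {q : (ZMod p)[X]} (hq : q ≠ 0) (b : ZMod p) :
    rp p (X * q + C b) = rp p q / p := by
  have h1 : (X * q + C b).natDegree = q.natDegree + 1 := by
    rw [natDegree_add_C, natDegree_X_mul hq]
  have h2 : (X * q + C b).leadingCoeff = q.leadingCoeff := by
    rw [leadingCoeff, h1, coeff_add, coeff_C_succ, add_zero, coeff_X_mul, leadingCoeff]
  unfold rp
  rw [h1, h2, div_div]
  congr 1
  ring

/-! ### Fourier analysis of digit vectors -/

/-- The integer whose base-`p` digits, the most significant one first, are the given ones. -/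
def digitVal : {m : ℕ} → (Fin m → ZMod p) → ℕ
  | 0, _ => 0
  | m + 1, a => (a 0).val * p ^ m + digitVal (Fin.tail a)

lemma digitVal_cons {m : ℕ} (b : ZMod p) (a : Fin m → ZMod p) :
    digitVal p (Fin.cons b a : Fin (m + 1) → ZMod p) = b.val * p ^ m + digitVal p a := by
  simp [digitVal]

lemma sum_range_mul_add {M : Type*} [AddCommMonoid M] (n P : ℕ) (F : ℕ → M) :
    ∑ b ∈ Finset.range n, ∑ j ∈ Finset.range P, F (b * P + j) = ∑ j ∈ Finset.range (n * P), F j := by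
  induction n with
  | zero => simp
  | succ k ih => rw [Finset.sum_range_succ, ih, Nat.succ_mul, Finset.sum_range_add]

lemma sum_digitVal {M : Type*} [AddCommMonoid M] (m : ℕ) (F : ℕ → M) :
    ∑ a : Fin m → ZMod p, F (digitVal p a) = ∑ j ∈ Finset.range (p ^ m), F j := by
  induction m generalizing F with
  | zero => simp [digitVal]
  | succ m ih =>
    rw [sum_cons]
    simp_rw [digitVal_cons]
    have : ∀ b : ZMod p, ∑ v : Fin m → ZMod p, F (b.val * p ^ m + digitVal p v)
        = ∑ j ∈ Finset.range (p ^ m), F (b.val * p ^ m + j) := fun b => ih fun j => F (b.val * p ^ m + j)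
    simp_rw [this]
    rw [sum_zmod_val p (fun b => ∑ j ∈ Finset.range (p ^ m), F (b * p ^ m + j)), sum_range_mul_add,
      pow_succ']

lemma digitVal_lt {m : ℕ} (a : Fin m → ZMod p) : digitVal p a < p ^ m := by
  induction m with
  | zero => simp [digitVal]
  | succ m ih =>
    have h1 := ih (Fin.tail a)
    have h2 := ZMod.val_lt (a 0)
    calc (a 0).val * p ^ m + digitVal p (Fin.tail a) < (a 0).val * p ^ m + p ^ m := by omega
      _ = ((a 0).val + 1) * p ^ m := by ring
      _ ≤ p * p ^ m := Nat.mul_le_mul_right _ h2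
      _ = p ^ (m + 1) := by ring

lemma stdAddChar_sum {ι : Type*} (S : Finset ι) (f : ι → ZMod p) :
    (ZMod.stdAddChar (∑ i ∈ S, f i) : ℂ) = ∏ i ∈ S, ZMod.stdAddChar (f i) := by
  classical
  induction S using Finset.induction_on with
  | empty => simp
  | insert i S hi ih => rw [Finset.sum_insert hi, Finset.prod_insert hi, AddChar.map_add_eq_mul, ih]

lemma sum_stdAddChar_dotProduct {m : ℕ} (h : Fin m → ZMod p) :
    ∑ a : Fin m → ZMod p, (ZMod.stdAddChar (a ⬝ᵥ h) : ℂ) = if h = 0 then (p : ℂ) ^ m else 0 := by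
  have h1 : ∀ a : Fin m → ZMod p,
      (ZMod.stdAddChar (a ⬝ᵥ h) : ℂ) = ∏ i, ZMod.stdAddChar (a i * h i) := by
    intro a
    rw [dotProduct, stdAddChar_sum]
  simp_rw [h1]
  rw [← Fintype.prod_sum (fun i (b : ZMod p) => (ZMod.stdAddChar (b * h i) : ℂ))]
  simp_rw [AddChar.sum_mulShift _ (ZMod.isPrimitive_stdAddChar p)]
  split_ifs with h0
  · subst h0
    simp [ZMod.card]
  · obtain ⟨i, hi⟩ := Function.ne_iff.1 h0
    refine Finset.prod_eq_zero (Finset.mem_univ i) ?_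
    rw [if_neg (by simpa using hi), Nat.cast_zero]

/-- Fourier coefficient of a function on digit vectors. -/
def fourierCoeffVec {m : ℕ} (f : (Fin m → ZMod p) → ℂ) (h : Fin m → ZMod p) : ℂ :=
  ((p : ℂ) ^ m)⁻¹ * ∑ a, f a * ZMod.stdAddChar (-(a ⬝ᵥ h))

lemma fourier_inversion {m : ℕ} (f : (Fin m → ZMod p) → ℂ) (a : Fin m → ZMod p) :
    f a = ∑ h, fourierCoeffVec p f h * ZMod.stdAddChar (h ⬝ᵥ a) := by
  have hp : ((p : ℂ) ^ m) ≠ 0 := pow_ne_zero _ (Nat.cast_ne_zero.2 (NeZero.ne p))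
  unfold fourierCoeffVec
  simp_rw [Finset.mul_sum, Finset.sum_mul]
  rw [Finset.sum_comm]
  have h1 : ∀ b : Fin m → ZMod p, ∑ h, ((p : ℂ) ^ m)⁻¹ * (f b * ZMod.stdAddChar (-(b ⬝ᵥ h))) *
      ZMod.stdAddChar (h ⬝ᵥ a) = if a = b then f a else 0 := by
    intro b
    have h2 : ∀ h : Fin m → ZMod p, ((p : ℂ) ^ m)⁻¹ * (f b * ZMod.stdAddChar (-(b ⬝ᵥ h))) *
      ZMod.stdAddChar (h ⬝ᵥ a) = ((p : ℂ) ^ m)⁻¹ * f b * ZMod.stdAddChar (h ⬝ᵥ (a - b)) := by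
      intro h
      have : h ⬝ᵥ (a - b) = -(b ⬝ᵥ h) + h ⬝ᵥ a := by
        rw [dotProduct_sub, dotProduct_comm b h]; ring
      rw [this, AddChar.map_add_eq_mul]
      ring
    simp_rw [h2]
    rw [← Finset.mul_sum, sum_stdAddChar_dotProduct]
    by_cases hab : a = b
    · subst hab; simp only [sub_self, if_true]; field_simp
    · simp [hab, sub_eq_zero]
  simp_rw [h1]
  simp

/-- Abel summation: the decrements of `c` are nonnegative and, with the boundary term `c n`, add up
to `c 0`. -/
lemma norm_sum_antitone_mul_le (c : ℕ → ℝ) (hc : Antitone c) (hc0 : ∀ n, 0 ≤ c n) (z : ℕ → ℂ)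
    (M : ℝ) (hz : ∀ n, ‖∑ b ∈ Finset.range n, z b‖ ≤ M) (n : ℕ) :
    ‖∑ b ∈ Finset.range n, (c b : ℂ) * z b‖ ≤ c 0 * M := by
  have key : ∀ n, ‖∑ b ∈ Finset.range n, (c b : ℂ) * z b - c n * ∑ b ∈ Finset.range n, z b‖
      ≤ (c 0 - c n) * M := by
    intro n
    induction n with
    | zero => simp
    | succ n ih =>
      have h1 : ∑ b ∈ Finset.range (n + 1), (c b : ℂ) * z b
          - c (n + 1) * ∑ b ∈ Finset.range (n + 1), z b
          = (∑ b ∈ Finset.range n, (c b : ℂ) * z b - c n * ∑ b ∈ Finset.range n, z b)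
            + ((c n - c (n + 1) : ℝ) : ℂ) * ∑ b ∈ Finset.range (n + 1), z b := by
        rw [Finset.sum_range_succ, Finset.sum_range_succ z]
        push_cast
        ring
      rw [h1]
      have h2 : 0 ≤ c n - c (n + 1) := sub_nonneg.2 (hc n.le_succ)
      refine (norm_add_le _ _).trans ?_
      rw [norm_mul, Complex.norm_real, Real.norm_of_nonneg h2]
      have := mul_le_mul_of_nonneg_left (hz (n + 1)) h2
      linarith
  have h3 : ‖(c n : ℂ) * ∑ b ∈ Finset.range n, z b‖ ≤ c n * M := by
    rw [norm_mul, Complex.norm_real, Real.norm_of_nonneg (hc0 n)]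
    exact mul_le_mul_of_nonneg_left (hz n) (hc0 n)
  have h4 := norm_add_le (∑ b ∈ Finset.range n, (c b : ℂ) * z b - c n * ∑ b ∈ Finset.range n, z b)
    ((c n : ℂ) * ∑ b ∈ Finset.range n, z b)
  rw [sub_add_cancel] at h4
  linarith [key n]

lemma sin_val_ne_zero {k : ZMod p} (hk : k ≠ 0) : Real.sin (Real.pi / p * k.val) ≠ 0 := by
  intro h
  have h1 := norm_stdAddChar_sub_one p k
  rw [h, mul_zero, abs_zero, norm_eq_zero, sub_eq_zero] at h1
  exact hk (ZMod.injective_stdAddChar (by rw [h1, AddChar.map_zero_eq_one]))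

/-- The geometric sum is at most `1/|sin|`; this is weakened to `1/sin²`, the form occurring in
`rp`. -/
lemma norm_geom_sum_le {k : ZMod p} (hk : k ≠ 0) (n : ℕ) :
    ‖∑ b ∈ Finset.range n, (ZMod.stdAddChar k : ℂ) ^ b‖
      ≤ 1 / Real.sin (Real.pi / p * k.val) ^ 2 := by
  have hs := sin_val_ne_zero p hk
  have hz1 : (ZMod.stdAddChar k : ℂ) ≠ 1 := by
    intro h
    exact hk (ZMod.injective_stdAddChar (by rw [h, AddChar.map_zero_eq_one]))
  rw [geom_sum_eq hz1, norm_div, norm_stdAddChar_sub_one, abs_mul, abs_two]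
  have h1 : ‖(ZMod.stdAddChar k : ℂ) ^ n - 1‖ ≤ 2 := by
    refine (norm_sub_le _ _).trans ?_
    rw [norm_pow, AddChar.norm_apply]
    norm_num
  have h2 : 0 < |Real.sin (Real.pi / p * k.val)| := abs_pos.2 hs
  have h3 : |Real.sin (Real.pi / p * k.val)| ≤ 1 := Real.abs_sin_le_one _
  rw [← sq_abs (Real.sin _), div_le_div_iff₀ (by positivity) (by positivity)]
  nlinarith

lemma sum_filter_digitVal_lt {m : ℕ} (k : ℕ) :
    ∑ a : Fin m → ZMod p, (if digitVal p a < k then (1 : ℂ) else 0) = (min k (p ^ m) : ℕ) := by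
  rw [sum_digitVal p m (fun j => if j < k then (1 : ℂ) else 0), Finset.sum_ite, Finset.sum_const_zero,
    add_zero, Finset.sum_const, nsmul_eq_mul, mul_one]
  congr 1
  have : (Finset.range (p ^ m)).filter (· < k) = Finset.range (min k (p ^ m)) := by
    ext j; simp; omega
  rw [this, Finset.card_range]

/-- Exponential sums over initial segments are bounded by `p ^ m * rp`. -/
lemma norm_box_sum_le {m : ℕ} (k : ℕ) (h : Fin m → ZMod p) (hh : h ≠ 0) :
    ‖∑ a : Fin m → ZMod p, (if digitVal p a < k then (1 : ℂ) else 0) * ZMod.stdAddChar (a ⬝ᵥ h)‖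
      ≤ (p : ℝ) ^ m * rp p (polyOf p h) := by
  have hp0 : (p : ℝ) ≠ 0 := Nat.cast_ne_zero.2 (NeZero.ne p)
  induction m generalizing k with
  | zero => exact absurd (Subsingleton.elim h 0) hh
  | succ m ih =>
    -- The most significant digit, paired with the lowest coefficient `h0`, cuts the initial segment
    -- into blocks of length `p^m`; truncated subtraction `k - b * p^m` makes blocks beyond `k`
    -- empty.
    obtain ⟨h0, h', rfl⟩ : ∃ h0 h', h = Fin.cons h0 h' := ⟨h 0, Fin.tail h, (Fin.cons_self_tail h).symm⟩
    have hsum : ∑ a : Fin (m + 1) → ZMod p, (if digitVal p a < k then (1 : ℂ) else 0) *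
        ZMod.stdAddChar (a ⬝ᵥ (Fin.cons h0 h' : Fin (m + 1) → ZMod p))
        = ∑ b : ZMod p, ZMod.stdAddChar (b * h0) * ∑ a : Fin m → ZMod p,
          (if digitVal p a < k - b.val * p ^ m then (1 : ℂ) else 0) * ZMod.stdAddChar (a ⬝ᵥ h') := by
      rw [sum_cons]
      refine Finset.sum_congr rfl fun b _ => ?_
      rw [Finset.mul_sum]
      refine Finset.sum_congr rfl fun a _ => ?_
      have e1 : (Fin.cons b a : Fin (m + 1) → ZMod p) ⬝ᵥ (Fin.cons h0 h' : Fin (m + 1) → ZMod p)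
          = b * h0 + a ⬝ᵥ h' := by
        simp [dotProduct, Fin.sum_univ_succ]
      have e2 : (digitVal p (Fin.cons b a : Fin (m + 1) → ZMod p) < k)
          ↔ (digitVal p a < k - b.val * p ^ m) := by
        rw [digitVal_cons]; omega
      rw [e1, AddChar.map_add_eq_mul]
      simp only [e2]
      ring
    rw [hsum, polyOf_cons]
    by_cases hz : h' = 0
    · subst hz
      have hh0 : h0 ≠ 0 := by
        rintro rfl
        apply hh
        funext i
        refine Fin.cases ?_ (fun j => ?_) i <;> simp
      simp only [dotProduct_zero, AddChar.map_zero_eq_one, mul_one, sum_filter_digitVal_lt,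
        stdAddChar_eq_pow]
      rw [sum_zmod_val p (fun b => (ZMod.stdAddChar h0 : ℂ) ^ b *
        ((min (k - b * p ^ m) (p ^ m) : ℕ) : ℂ))]
      -- When `h' = 0` each block contributes only its size, and block sizes decrease in `b`, so
      -- Abel summation applies.
      have h5 := norm_sum_antitone_mul_le (fun b => ((min (k - b * p ^ m) (p ^ m) : ℕ) : ℝ))
        (fun b b' hb => Nat.cast_le.2 (min_le_min_right _
          (Nat.sub_le_sub_left (Nat.mul_le_mul_right _ hb) _)))
        (fun _ => Nat.cast_nonneg _) _ _ (norm_geom_sum_le p hh0) p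
      simp only [mul_comm ((ZMod.stdAddChar h0 : ℂ) ^ _)]
      simp only [Complex.ofReal_natCast] at h5
      refine h5.trans ?_
      have h6 : rp p (X * polyOf p (0 : Fin m → ZMod p) + C h0)
          = 1 / p * (1 / Real.sin (Real.pi / p * h0.val) ^ 2) := by
        rw [polyOf_zero, mul_zero, zero_add]
        unfold rp
        simp only [natDegree_C, leadingCoeff_C, zero_add, pow_one]
        rw [one_div_mul_one_div]
      rw [h6, ← mul_assoc]
      refine mul_le_mul_of_nonneg_right ?_ (by positivity)
      rw [pow_succ, mul_assoc, mul_one_div_cancel hp0, mul_one]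
      exact_mod_cast min_le_right _ _
    · have hq : polyOf p h' ≠ 0 := fun h => hz ((polyOf_eq_zero_iff p h').1 h)
      rw [rp_X_mul_add_C p hq]
      have hP : 0 < p ^ m := pow_pos (Nat.pos_of_ne_zero (NeZero.ne p)) m
      -- Full blocks vanish by orthogonality and empty ones trivially, so only the block cut by `k`
      -- can survive. For `k` past the end the residue may name another block, which is harmless
      -- since the induction hypothesis holds for every cutoff.
      have hvan : ∀ b : ZMod p, b ≠ ((k / p ^ m : ℕ) : ZMod p) →
          ∑ a : Fin m → ZMod p, (if digitVal p a < k - b.val * p ^ m then (1 : ℂ) else 0) *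
            ZMod.stdAddChar (a ⬝ᵥ h') = 0 := by
        intro b hb
        have hne : b.val ≠ k / p ^ m := by
          intro h
          exact hb (by rw [← h, ZMod.natCast_zmod_val])
        rcases lt_or_gt_of_ne hne with hlt | hgt
        · have h7 : ∀ a : Fin m → ZMod p, digitVal p a < k - b.val * p ^ m := by
            intro a
            have h8 := digitVal_lt p a
            have h9 : (b.val + 1) * p ^ m ≤ k := (Nat.le_div_iff_mul_le hP).1 hlt
            rw [Nat.succ_mul] at h9
            omega
          simp only [h7, if_true, one_mul]
          rw [sum_stdAddChar_dotProduct, if_neg hz]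
        · have h7 : k < b.val * p ^ m := (Nat.div_lt_iff_lt_mul hP).1 hgt
          have h8 : k - b.val * p ^ m = 0 := by omega
          simp [h8]
      rw [Finset.sum_eq_single ((k / p ^ m : ℕ) : ZMod p)
        (fun b _ hb => by rw [hvan b hb, mul_zero]) (by simp)]
      rw [norm_mul, AddChar.norm_apply, one_mul]
      refine (ih _ h' hz).trans (le_of_eq ?_)
      field_simp
      ring

/-- The indicator function of an initial segment of digit vectors. -/
def boxFun (m k : ℕ) (a : Fin m → ZMod p) : ℂ := if digitVal p a < k then 1 else 0

lemma norm_fourierCoeffVec_boxFun_le {m : ℕ} (k : ℕ) (h : Fin m → ZMod p) (hh : h ≠ 0) :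
    ‖fourierCoeffVec p (boxFun p m k) h‖ ≤ rp p (polyOf p h) := by
  have hp0 : (p : ℝ) ^ m ≠ 0 := pow_ne_zero _ (Nat.cast_ne_zero.2 (NeZero.ne p))
  have h1 := norm_box_sum_le p k h hh
  have h2 : ∑ a : Fin m → ZMod p, boxFun p m k a * ZMod.stdAddChar (-(a ⬝ᵥ h))
      = (starRingEnd ℂ) (∑ a : Fin m → ZMod p, (if digitVal p a < k then (1 : ℂ) else 0) *
        ZMod.stdAddChar (a ⬝ᵥ h)) := by
    rw [map_sum]
    refine Finset.sum_congr rfl fun a _ => ?_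
    rw [map_mul, AddChar.map_neg_eq_conj, boxFun]
    split_ifs <;> simp
  unfold fourierCoeffVec
  rw [h2, norm_mul, RCLike.norm_conj, norm_inv, norm_pow, Complex.norm_natCast,
    inv_mul_le_iff₀ (by positivity)]
  exact h1

lemma fourierCoeffVec_boxFun_zero {m : ℕ} {k : ℕ} (hk : k ≤ p ^ m) :
    fourierCoeffVec p (boxFun p m k) 0 = k / (p : ℂ) ^ m := by
  unfold fourierCoeffVec boxFun
  simp only [dotProduct_zero, neg_zero, AddChar.map_zero_eq_one, mul_one]
  rw [sum_filter_digitVal_lt, min_eq_left hk, inv_mul_eq_div]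

/-- The box is everything, so the function is constant. This removes nonzero frequencies in
coordinates outside `u`, where no weight `γ_j` is available. -/
lemma fourierCoeffVec_boxFun_top {m : ℕ} (h : Fin m → ZMod p) (hh : h ≠ 0) :
    fourierCoeffVec p (boxFun p m (p ^ m)) h = 0 := by
  unfold fourierCoeffVec boxFun
  have : ∀ a : Fin m → ZMod p, (ZMod.stdAddChar (-(a ⬝ᵥ h)) : ℂ) = ZMod.stdAddChar (a ⬝ᵥ (-h)) := by
    intro a; rw [dotProduct_neg]
  simp only [digitVal_lt, if_true, one_mul, this]
  rw [sum_stdAddChar_dotProduct, if_neg (neg_ne_zero.2 hh), mul_zero]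

/-! ### Digits of the lattice points -/

lemma digitPoly_eq_polyOf (m n : ℕ) :
    digitPoly p m n = polyOf p (fun i : Fin m => ((n / p ^ (i : ℕ) % p : ℕ) : ZMod p)) := by
  unfold digitPoly polyOf
  rw [← Fin.sum_univ_eq_sum_range (fun r => C ((n / p ^ r % p : ℕ) : ZMod p) * X ^ r)]

lemma sum_digitPoly {M : Type*} [AddCommMonoid M] (m : ℕ) (F : (ZMod p)[X] → M) :
    ∑ n : Fin (p ^ m), F (digitPoly p m n) = ∑ v : Fin m → ZMod p, F (polyOf p v) := by
  simp_rw [digitPoly_eq_polyOf]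
  set e : Fin (p ^ m) → Fin m → ZMod p :=
    fun n i => (((n : ℕ) / p ^ (i : ℕ) % p : ℕ) : ZMod p) with he
  have hinj : Function.Injective e := by
    intro n n' h
    apply (finFunctionFinEquiv (m := p) (n := m)).symm.injective
    funext i
    apply Fin.ext
    rw [finFunctionFinEquiv_symm_apply_val, finFunctionFinEquiv_symm_apply_val]
    have h1 := congrFun h i
    have hp : 0 < p := Nat.pos_of_ne_zero (NeZero.ne p)
    have h2 := congrArg ZMod.val h1
    simp only [he] at h2
    rwa [ZMod.val_cast_of_lt (Nat.mod_lt _ hp), ZMod.val_cast_of_lt (Nat.mod_lt _ hp)] at h2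
  have hbij : Function.Bijective e := by
    rw [Fintype.bijective_iff_injective_and_card]
    exact ⟨hinj, by simp [ZMod.card]⟩
  exact (Equiv.ofBijective e hbij).sum_comp (fun v => F (polyOf p v))

lemma laurentAtInfty_X_pow (k : ℕ) :
    laurentAtInfty p (X ^ k) = HahnSeries.single (-(k : ℤ)) (1 : ZMod p) := by
  unfold laurentAtInfty
  rw [map_pow, aeval_X, HahnSeries.single_pow]
  simp

lemma laurentAtInfty_div_X_pow_coeff (q : (ZMod p)[X]) (m l : ℕ) (hl : l ≤ m) :
    (laurentAtInfty p q / laurentAtInfty p (X ^ m)).coeff (l : ℤ) = q.coeff (m - l) := by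
  have hinv : (laurentAtInfty p (X ^ m))⁻¹ = HahnSeries.single (m : ℤ) (1 : ZMod p) := by
    rw [laurentAtInfty_X_pow, HahnSeries.inv_single]
    simp
  rw [div_eq_mul_inv, hinv]
  induction q using Polynomial.induction_on' with
  | add q r hq hr => rw [map_add, add_mul, HahnSeries.coeff_add, hq, hr, coeff_add]
  | monomial k c =>
    have hC : algebraMap (ZMod p) (LaurentSeries (ZMod p)) c = HahnSeries.single 0 c := by
      rw [HahnSeries.algebraMap_apply']
      simp
    rw [← C_mul_X_pow_eq_monomial, map_mul, laurentAtInfty_X_pow, ← algebraMap_eq,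
      AlgHom.commutes, mul_assoc, HahnSeries.single_mul_single, algebraMap_eq, coeff_C_mul,
      coeff_X_pow, hC, HahnSeries.single_mul_single,
      HahnSeries.coeff_single, mul_ite, mul_zero]
    simp only [mul_one]
    refine if_congr ?_ rfl rfl
    omega

/-- The coefficients of `q` at `x^{m-1}, …, x^0`: the first `m` digits of `q / x^m`. -/
def topDigits (m : ℕ) (q : (ZMod p)[X]) : Fin m → ZMod p := fun l => q.coeff (m - 1 - l)

lemma sum_digits_div {m : ℕ} (a : Fin m → ZMod p) :
    ∑ l : Fin m, ((a l).val : ℝ) / (p : ℝ) ^ ((l : ℕ) + 1) = digitVal p a / (p : ℝ) ^ m := by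
  have hp0 : (p : ℝ) ≠ 0 := Nat.cast_ne_zero.2 (NeZero.ne p)
  induction m with
  | zero => simp [digitVal]
  | succ m ih =>
    rw [Fin.sum_univ_succ]
    have h := ih (Fin.tail a)
    have h2 : ∀ l : Fin m, ((a l.succ).val : ℝ) / (p : ℝ) ^ ((l.succ : ℕ) + 1)
        = 1 / p * (((Fin.tail a l).val : ℝ) / (p : ℝ) ^ ((l : ℕ) + 1)) := by
      intro l
      rw [Fin.val_succ, pow_succ _ ((l : ℕ) + 1), Fin.tail]
      field_simp
    simp_rw [h2]
    rw [← Finset.mul_sum, h, digitVal]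
    push_cast
    simp only [Fin.val_zero, zero_add, pow_one]
    field_simp
    ring

lemma phi_div_X_pow (m : ℕ) (q : (ZMod p)[X]) :
    phi p m (laurentAtInfty p q / laurentAtInfty p (X ^ m))
      = digitVal p (topDigits p m q) / (p : ℝ) ^ m := by
  rw [← sum_digits_div, phi]
  unfold topDigits
  rw [Fin.sum_univ_eq_sum_range (fun l => ((q.coeff (m - 1 - l)).val : ℝ) / (p : ℝ) ^ (l + 1))]
  have h := Finset.sum_Ico_add' (fun l => ((q.coeff (m - l)).val : ℝ) / (p : ℝ) ^ l) 0 m 1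
  simp only [add_comm _ 1, ← Nat.sub_sub] at h
  simp only [Finset.range_eq_Ico, add_comm _ 1]
  have hI : Finset.Icc 1 m = Finset.Ico (1 + 0) (1 + m) := by ext l; simp; omega
  rw [h, ← hI]
  refine Finset.sum_congr rfl fun l hl => ?_
  rw [laurentAtInfty_div_X_pow_coeff p q m l (Finset.mem_Icc.1 hl).2]

/-- The pairing is the `x^{-1}` coefficient of `h q / x^m`. Being a coefficient of a product, it
lets `h` and the lattice index trade places in `mean_prod_eq_sum_dual`. -/
lemma dotProduct_topDigits {m : ℕ} (h : Fin m → ZMod p) (q : (ZMod p)[X]) :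
    h ⬝ᵥ topDigits p m q = (polyOf p h * q).coeff (m - 1) := by
  unfold polyOf topDigits dotProduct
  rw [Finset.sum_mul, finsetSum_coeff]
  refine Finset.sum_congr rfl fun i _ => ?_
  rw [mul_assoc, coeff_C_mul, coeff_X_pow_mul', if_pos (by have := i.isLt; omega)]

lemma topDigits_eq_zero_iff (m : ℕ) (q : (ZMod p)[X]) : topDigits p m q = 0 ↔ X ^ m ∣ q := by
  rw [X_pow_dvd_iff]
  constructor
  · intro h d hd
    have := congrFun h ⟨m - 1 - d, by omega⟩
    simp only [topDigits, Pi.zero_apply] at this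
    rwa [show m - 1 - (m - 1 - d) = d by omega] at this
  · intro h
    funext l
    exact h _ (by have := l.isLt; omega)

/-! ### The dual net -/

open Classical in
/-- The proportion of lattice points in a box with corner on the grid is a sum of Fourier
coefficients over the dual net. -/
lemma mean_prod_eq_sum_dual (m : ℕ) {s : ℕ} (G : Fin s → (ZMod p)[X])
    (f : Fin s → (Fin m → ZMod p) → ℂ) :
    ((p : ℂ) ^ m)⁻¹ * ∑ n : Fin (p ^ m), ∏ j, f j (topDigits p m (digitPoly p m n * G j))
      = ∑ h : Fin s → Fin m → ZMod p with X ^ m ∣ ∑ j, polyOf p (h j) * G j,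
          ∏ j, fourierCoeffVec p (f j) (h j) := by
  have hp : ((p : ℂ) ^ m) ≠ 0 := pow_ne_zero _ (Nat.cast_ne_zero.2 (NeZero.ne p))
  rw [sum_digitPoly p m (fun q => ∏ j, f j (topDigits p m (q * G j)))]
  have h1 : ∀ v : Fin m → ZMod p, ∏ j, f j (topDigits p m (polyOf p v * G j))
      = ∑ h : Fin s → Fin m → ZMod p, (∏ j, fourierCoeffVec p (f j) (h j)) *
          ZMod.stdAddChar (v ⬝ᵥ topDigits p m (∑ j, polyOf p (h j) * G j)) := by
    intro v
    have h2 : ∀ j, f j (topDigits p m (polyOf p v * G j)) = ∑ h : Fin m → ZMod p,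
        fourierCoeffVec p (f j) h * ZMod.stdAddChar (h ⬝ᵥ topDigits p m (polyOf p v * G j)) :=
      fun j => fourier_inversion p (f j) _
    simp_rw [h2]
    rw [Fintype.prod_sum]
    refine Finset.sum_congr rfl fun h _ => ?_
    rw [Finset.prod_mul_distrib, ← stdAddChar_sum]
    -- Both sides are the coefficient of `x^{m-1}` in `v · ∑ h_j G_j`; the sum over `v` then detects
    -- when `x^m` divides `∑ h_j G_j`.
    have h3 : ∑ j, h j ⬝ᵥ topDigits p m (polyOf p v * G j)
        = v ⬝ᵥ topDigits p m (∑ j, polyOf p (h j) * G j) := by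
      simp_rw [dotProduct_topDigits]
      rw [← finsetSum_coeff, Finset.mul_sum]
      simp_rw [mul_left_comm]
    rw [h3]
  simp_rw [h1]
  rw [Finset.sum_comm]
  simp_rw [← Finset.mul_sum, sum_stdAddChar_dotProduct, topDigits_eq_zero_iff]
  rw [Finset.sum_filter, Finset.mul_sum]
  refine Finset.sum_congr rfl fun h _ => ?_
  split_ifs
  · field_simp
  · simp

open Classical in
lemma figureR_eq_sum_vec (m : ℕ) (γ : ℕ → ℝ) {d : ℕ} (G : Fin d → (ZMod p)[X]) (f : (ZMod p)[X]) :
    figureR p m γ G f = ∑ h : Fin d → Fin m → ZMod p with h ≠ 0 ∧ f ∣ ∑ i, polyOf p (h i) * G i,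
      ∏ i, rpWeighted p (polyOf p (h i)) (γ i) := by
  unfold figureR
  symm
  refine Finset.sum_nbij (fun h i => polyOf p (h i)) ?_ ?_ ?_ (fun _ _ => rfl)
  · intro h hh
    simp only [Finset.mem_filter, Finset.mem_univ, true_and] at hh
    simp only [Finset.mem_filter, Fintype.mem_piFinset, mem_polysLT]
    refine ⟨fun i => degree_polyOf_lt p _, fun h0 => hh.1 ?_, hh.2⟩
    funext i
    exact (polyOf_eq_zero_iff p _).1 (congrFun h0 i)
  · intro h _ h' _ he
    funext i
    exact polyOf_injective p m (congrFun he i)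
  · intro q hq
    simp only [Finset.coe_filter, Fintype.mem_piFinset, mem_polysLT, Set.mem_ofPred_eq] at hq
    have hq' : ∀ i, polyOf p (fun l : Fin m => (q i).coeff l) = q i := fun i => polyOf_coeff p (hq.1 i)
    refine ⟨fun i l => (q i).coeff l, ?_, funext hq'⟩
    simp only [Finset.coe_filter, Finset.mem_univ, true_and, Set.mem_ofPred_eq, hq']
    refine ⟨fun h0 => hq.2.1 ?_, hq.2.2⟩
    funext i
    rw [← hq' i]
    have : (fun l : Fin m => (q i).coeff l) = 0 := congrFun h0 i
    rw [this]
    simp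

lemma rpWeighted_nonneg {γ : ℝ} (hγ : 0 ≤ γ) (h : (ZMod p)[X]) : 0 ≤ rpWeighted p h γ := by
  unfold rpWeighted
  split_ifs
  · linarith
  · exact mul_nonneg hγ (rp_nonneg p h)

/-! ### The discrepancy bound -/

lemma prod_sub_prod_le {ι : Type*} (u : Finset ι) (a b : ι → ℝ) (δ : ℝ) (hδ0 : 0 ≤ δ) (hδ1 : δ ≤ 1)
    (hb : ∀ i ∈ u, 0 ≤ b i) (hba : ∀ i ∈ u, b i ≤ a i) (hab : ∀ i ∈ u, a i ≤ b i + δ)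
    (ha : ∀ i ∈ u, a i ≤ 1) : ∏ i ∈ u, a i - ∏ i ∈ u, b i ≤ 1 - (1 - δ) ^ u.card := by
  classical
  induction u using Finset.induction_on with
  | empty => simp
  | insert i u hi ih =>
    simp only [Finset.mem_insert, forall_eq_or_imp] at hb hba hab ha
    have h := ih hb.2 hba.2 hab.2 ha.2
    rw [Finset.prod_insert hi, Finset.prod_insert hi, Finset.card_insert_of_notMem hi]
    set A := ∏ i ∈ u, a i
    set B := ∏ i ∈ u, b i
    have hB : 0 ≤ B := Finset.prod_nonneg hb.2
    have hBA : B ≤ A := Finset.prod_le_prod hb.2 hba.2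
    have hA : A ≤ 1 := Finset.prod_le_one (fun i hi => (hb.2 i hi).trans (hba.2 i hi)) ha.2
    -- Write the left side as `a_i (A - B) + (a_i - b_i) B` and use `a_i ≤ 1` and `a_i - b_i ≤ δ`.
    -- The right side is `δ A + (1 - δ)(A - B)`, ready for induction.
    have e1 : a i * A - b i * B ≤ A - (1 - δ) * B := by
      nlinarith [mul_nonneg (sub_nonneg.2 ha.1) (sub_nonneg.2 hBA),
        mul_nonneg (sub_nonneg.2 hab.1) hB]
    have e2 := mul_le_mul_of_nonneg_left h (sub_nonneg.2 hδ1)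
    rw [pow_succ]
    nlinarith [mul_le_mul_of_nonneg_left hA hδ0]

lemma indicator_latticePoints (m : ℕ) {s : ℕ} (G : Fin s → (ZMod p)[X]) (t : Fin s → ℝ)
    (n : Fin (p ^ m)) :
    ((Set.indicator {y : Fin s → ℝ | ∀ j, 0 ≤ y j ∧ y j < t j} (fun _ => (1 : ℝ))
        (latticePoints p m G (X ^ m) n) : ℝ) : ℂ)
      = ∏ j, boxFun p m ⌈t j * (p : ℝ) ^ m⌉₊ (topDigits p m (digitPoly p m n * G j)) := by
  have hp : 0 < (p : ℝ) ^ m := pow_pos (Nat.cast_pos.2 (Nat.pos_of_ne_zero (NeZero.ne p))) m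
  have h1 : ∀ j, (0 ≤ latticePoints p m G (X ^ m) n j ∧ latticePoints p m G (X ^ m) n j < t j) ↔
      digitVal p (topDigits p m (digitPoly p m n * G j)) < ⌈t j * (p : ℝ) ^ m⌉₊ := by
    intro j
    rw [latticePoints, phi_div_X_pow, Nat.lt_ceil, div_lt_iff₀ hp]
    exact and_iff_right (by positivity)
  unfold boxFun
  rw [Set.indicator_apply]
  simp only [Set.mem_ofPred_eq, h1]
  rw [Fintype.prod_ite_zero]
  split_ifs <;> simp

/-- Factor by factor: at `h_j = 0` both `γ_j` and `1` are at most `1 + γ_j`; at `h_j ≠ 0` the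
coefficient is at most `r_p` if `j ∈ u` and zero otherwise. -/
lemma weight_mul_norm_prod_le (m : ℕ) {s : ℕ} (γ : ℕ → ℝ) (hγ : ∀ j, 0 ≤ γ j)
    (u : Finset (Fin s)) (k : Fin s → ℕ) (hk : ∀ j, k j ≤ p ^ m) (hku : ∀ j ∉ u, k j = p ^ m)
    (h : Fin s → Fin m → ZMod p) :
    productWeight γ u * ‖∏ j, fourierCoeffVec p (boxFun p m (k j)) (h j)‖
      ≤ ∏ j, rpWeighted p (polyOf p (h j)) (γ j) := by
  classical
  have hp : 0 < (p : ℝ) ^ m := pow_pos (Nat.cast_pos.2 (Nat.pos_of_ne_zero (NeZero.ne p))) m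
  have e : productWeight γ u = ∏ j : Fin s, if j ∈ u then γ j else 1 := by
    rw [productWeight, Finset.prod_ite_mem, Finset.univ_inter]
  rw [e, norm_prod, ← Finset.prod_mul_distrib]
  refine Finset.prod_le_prod (fun j _ => ?_) (fun j _ => ?_)
  · refine mul_nonneg ?_ (norm_nonneg _)
    split_ifs
    · exact hγ j
    · exact zero_le_one
  · by_cases h0 : h j = 0
    · have h1 : ‖fourierCoeffVec p (boxFun p m (k j)) (h j)‖ ≤ 1 := by
        rw [h0, fourierCoeffVec_boxFun_zero p (hk j), norm_div, norm_pow, Complex.norm_natCast,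
          Complex.norm_natCast, div_le_one hp]
        exact_mod_cast hk j
      rw [rpWeighted, if_pos ((polyOf_eq_zero_iff p _).2 h0)]
      have h2 := norm_nonneg (fourierCoeffVec p (boxFun p m (k j)) (h j))
      have h3 := hγ j
      split_ifs
      · nlinarith
      · linarith
    · rw [rpWeighted, if_neg (fun h' => h0 ((polyOf_eq_zero_iff p _).1 h'))]
      split_ifs with hu
      · exact mul_le_mul_of_nonneg_left (norm_fourierCoeffVec_boxFun_le p _ _ h0) (hγ j)
      · rw [hku j hu, fourierCoeffVec_boxFun_top p _ h0, norm_zero, mul_zero]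
        exact mul_nonneg (hγ j) (rp_nonneg p _)

/-- On boxes with corner on the grid, the weighted local discrepancy is at most `R`. -/
lemma weight_mul_grid_discrepancy_le (m : ℕ) {s : ℕ} (γ : ℕ → ℝ) (hγ : ∀ j, 0 ≤ γ j)
    (G : Fin s → (ZMod p)[X]) (u : Finset (Fin s)) (k : Fin s → ℕ) (hk : ∀ j, k j ≤ p ^ m)
    (hku : ∀ j ∉ u, k j = p ^ m) :
    productWeight γ u * ‖((p : ℂ) ^ m)⁻¹ * ∑ n : Fin (p ^ m),
        ∏ j, boxFun p m (k j) (topDigits p m (digitPoly p m n * G j)) - ∏ j, (k j / (p : ℂ) ^ m)‖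
      ≤ figureR p m γ G (X ^ m) := by
  classical
  have hu0 : 0 ≤ productWeight γ u := Finset.prod_nonneg fun j _ => hγ j
  rw [mean_prod_eq_sum_dual p m G (fun j => boxFun p m (k j)), figureR_eq_sum_vec]
  have h0 : (0 : Fin s → Fin m → ZMod p) ∈ (Finset.univ : Finset (Fin s → Fin m → ZMod p)).filter
      (fun h => X ^ m ∣ ∑ j, polyOf p (h j) * G j) := by simp
  rw [← Finset.add_sum_erase _ _ h0]
  have h1 : ∏ j, fourierCoeffVec p (boxFun p m (k j)) ((0 : Fin s → Fin m → ZMod p) j)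
      = ∏ j, (k j / (p : ℂ) ^ m) :=
    Finset.prod_congr rfl fun j _ => fourierCoeffVec_boxFun_zero p (hk j)
  rw [h1, add_sub_cancel_left]
  refine (mul_le_mul_of_nonneg_left (norm_sum_le _ _) hu0).trans ?_
  rw [Finset.mul_sum]
  refine (Finset.sum_le_sum fun h _ => weight_mul_norm_prod_le p m γ hγ u k hk hku h).trans
    (le_of_eq (Finset.sum_congr ?_ fun _ _ => rfl))
  ext h
  simp

/-- The weighted local discrepancy is at most the discretization error plus `R`. -/
lemma weight_mul_localDiscrepancy_le (m : ℕ) {s : ℕ} (γ : ℕ → ℝ) (hγ : ∀ j, 0 ≤ γ j)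
    (G : Fin s → (ZMod p)[X]) (u : Finset (Fin s)) (t : Fin s → ℝ)
    (ht : ∀ j, 0 < t j ∧ t j ≤ 1) :
    productWeight γ u * |localDiscrepancy (latticePoints p m G (X ^ m)) (fillOnes u t)|
      ≤ productWeight γ u * (1 - (1 - 1 / (p : ℝ) ^ m) ^ u.card) + figureR p m γ G (X ^ m) := by
  classical
  have hp : 0 < (p : ℝ) ^ m := pow_pos (Nat.cast_pos.2 (Nat.pos_of_ne_zero (NeZero.ne p))) m
  have hp1 : 1 ≤ (p : ℝ) ^ m := by
    exact_mod_cast Nat.one_le_pow _ _ (Nat.pos_of_ne_zero (NeZero.ne p))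
  have hu0 : 0 ≤ productWeight γ u := Finset.prod_nonneg fun j _ => hγ j
  -- Grid corner obtained by rounding up: a grid point `a / p^m` lies below `t_j` exactly when `a <
  -- k j`.
  set k : Fin s → ℕ := fun j => ⌈fillOnes u t j * (p : ℝ) ^ m⌉₊ with hkdef
  have hfu : ∀ j ∈ u, fillOnes u t j = t j := fun j hj => by simp [fillOnes, hj]
  have hfn : ∀ j ∉ u, fillOnes u t j = 1 := fun j hj => by simp [fillOnes, hj]
  have hf1 : ∀ j, fillOnes u t j ≤ 1 := fun j => by
    by_cases hj : j ∈ u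
    · rw [hfu j hj]; exact (ht j).2
    · rw [hfn j hj]
  have hk : ∀ j, k j ≤ p ^ m := by
    intro j
    refine Nat.ceil_le.2 ?_
    push_cast
    exact mul_le_of_le_one_left hp.le (hf1 j)
  have hku : ∀ j ∉ u, k j = p ^ m := by
    intro j hj
    simp only [hkdef]
    rw [hfn j hj, one_mul]
    exact_mod_cast Nat.ceil_natCast (R := ℝ) (p ^ m)
  have hgrid := weight_mul_grid_discrepancy_le p m γ hγ G u k hk hku
  set S : ℝ := 1 / ((p ^ m : ℕ) : ℝ) * ∑ n : Fin (p ^ m),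
    Set.indicator {y : Fin s → ℝ | ∀ j, 0 ≤ y j ∧ y j < fillOnes u t j} (fun _ => (1 : ℝ))
      (latticePoints p m G (X ^ m) n) with hS
  have hcast : ((p : ℂ) ^ m)⁻¹ * ∑ n : Fin (p ^ m),
        ∏ j, boxFun p m (k j) (topDigits p m (digitPoly p m n * G j)) - ∏ j, (k j / (p : ℂ) ^ m)
      = ((S - ∏ j, (k j / (p : ℝ) ^ m) : ℝ) : ℂ) := by
    rw [hS]
    push_cast
    simp_rw [indicator_latticePoints]
    rw [one_div]
  rw [hcast, Complex.norm_real, Real.norm_eq_abs] at hgrid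
  have hprodk : ∏ j, ((k j : ℝ) / (p : ℝ) ^ m) = ∏ j ∈ u, ((k j : ℝ) / (p : ℝ) ^ m) := by
    refine (Finset.prod_subset (Finset.subset_univ u) fun j _ hj => ?_).symm
    rw [hku j hj]
    push_cast
    exact div_self hp.ne'
  have hprodt : ∏ j, fillOnes u t j = ∏ j ∈ u, t j := by
    rw [← Finset.prod_congr rfl hfu]
    exact (Finset.prod_subset (Finset.subset_univ u) fun j _ hj => hfn j hj).symm
  have hle : ∀ j ∈ u, t j ≤ (k j : ℝ) / (p : ℝ) ^ m := by
    intro j hj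
    rw [le_div_iff₀ hp, ← hfu j hj]
    exact Nat.le_ceil _
  have hround := prod_sub_prod_le u (fun j => (k j : ℝ) / (p : ℝ) ^ m) t (1 / (p : ℝ) ^ m)
    (by positivity) ((div_le_one hp).2 hp1) (fun j _ => (ht j).1.le) hle
    (fun j hj => by
      rw [div_le_iff₀ hp, add_mul, div_mul_cancel₀ _ hp.ne', ← hfu j hj]
      refine (Nat.ceil_lt_add_one ?_).le
      rw [hfu j hj]
      exact mul_nonneg (ht j).1.le hp.le)
    (fun j _ => (div_le_one hp).2 (by exact_mod_cast hk j))
  have hround0 : ∏ j ∈ u, t j ≤ ∏ j ∈ u, ((k j : ℝ) / (p : ℝ) ^ m) :=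
    Finset.prod_le_prod (fun j _ => (ht j).1.le) hle
  have hloc : localDiscrepancy (latticePoints p m G (X ^ m)) (fillOnes u t)
      = (S - ∏ j, ((k j : ℝ) / (p : ℝ) ^ m))
        + (∏ j ∈ u, ((k j : ℝ) / (p : ℝ) ^ m) - ∏ j ∈ u, t j) := by
    rw [localDiscrepancy, hprodt, hprodk]
    ring
  rw [hloc]
  refine (mul_le_mul_of_nonneg_left (abs_add_le _ _) hu0).trans ?_
  rw [mul_add, abs_of_nonneg (sub_nonneg.2 hround0)]
  have := mul_le_mul_of_nonneg_left hround hu0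
  linarith

/-! ### Sums of `r_p` -/

/-- A consequence of `1 / 0 = 0`; it lets `b = 0` be included freely in sums of `rp`. -/
lemma rp_zero : rp p 0 = 0 := by simp [rp]

lemma rp_X_pow_mul (e : ℕ) (q : (ZMod p)[X]) : rp p (X ^ e * q) = rp p q / (p : ℝ) ^ e := by
  by_cases hq : q = 0
  · simp [hq, rp_zero]
  induction e with
  | zero => simp
  | succ e ih =>
    have h := rp_X_mul_add_C p (mul_ne_zero (pow_ne_zero e X_ne_zero) hq) 0
    rw [C_0, add_zero, ih, div_div, ← pow_succ] at h
    rw [pow_succ', mul_assoc, h]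

lemma rp_add_C_mul_X_pow {m : ℕ} {q : (ZMod p)[X]} (hq : q.degree < m) {b : ZMod p} (hb : b ≠ 0) :
    rp p (q + C b * X ^ m) = 1 / (p : ℝ) ^ (m + 1) * (1 / Real.sin (Real.pi / p * b.val) ^ 2) := by
  have hlt : q.degree < (C b * X ^ m).degree := by rwa [degree_C_mul_X_pow m hb]
  have h1 : (q + C b * X ^ m).natDegree = m :=
    natDegree_eq_of_degree_eq_some
      ((degree_add_eq_right_of_degree_lt hlt).trans (degree_C_mul_X_pow m hb))
  have h2 : (q + C b * X ^ m).leadingCoeff = b := by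
    rw [leadingCoeff_add_of_degree_lt hlt, leadingCoeff_C_mul_X_pow]
  rw [rp, h1, h2, one_div_mul_one_div]

/-- `∑_h r_p(h) = m (p² - 1) / (3p)`, over the polynomials of degree `< m`. -/
lemma sum_rp (m : ℕ) :
    ∑ h ∈ polysLT p m, rp p h = m * (((p : ℝ) ^ 2 - 1) / (3 * p)) := by
  have hp0 : (p : ℝ) ≠ 0 := Nat.cast_ne_zero.2 (NeZero.ne p)
  induction m with
  | zero => rw [sum_polysLT]; simp [polyOf, rp_zero]
  | succ m ih =>
    rw [sum_polysLT] at ih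
    rw [sum_polysLT, sum_snoc]
    simp_rw [polyOf_snoc]
    rw [← Finset.add_sum_erase _ _ (Finset.mem_univ (0 : ZMod p))]
    simp only [C_0, zero_mul, add_zero]
    rw [ih]
    have h : ∀ b ∈ (Finset.univ : Finset (ZMod p)).erase 0,
        ∑ v : Fin m → ZMod p, rp p (polyOf p v + C b * X ^ m)
          = 1 / p * (1 / Real.sin (Real.pi / p * b.val) ^ 2) := by
      intro b hb
      -- There are `p^m` polynomials of degree `m` with leading coefficient `b`, all with the same
      -- `rp`, so each degree contributes `(p² - 1)/(3p)`.
      simp_rw [rp_add_C_mul_X_pow p (degree_polyOf_lt p _) (Finset.ne_of_mem_erase hb)]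
      rw [Finset.sum_const, Finset.card_univ, Fintype.card_fun, ZMod.card, Fintype.card_fin,
        nsmul_eq_mul, ← mul_assoc]
      push_cast
      rw [pow_succ]
      congr 1
      field_simp
    rw [Finset.sum_congr rfl h, ← Finset.mul_sum, sum_one_div_sin_sq]
    push_cast
    field_simp

/-- Dividing by `x^e` scales `rp` by `p^e`; allowing all quotients of degree `< m` keeps the bound
simple. -/
lemma sum_rp_X_pow_dvd_le (m e : ℕ) [DecidablePred fun h : (ZMod p)[X] => X ^ e ∣ h] :
    ∑ h ∈ polysLT p m with X ^ e ∣ h, rp p h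
      ≤ m * (((p : ℝ) ^ 2 - 1) / (3 * p)) / (p : ℝ) ^ e := by
  classical
  have hsub : (polysLT p m).filter (fun h => X ^ e ∣ h)
      ⊆ (polysLT p m).image (fun q => X ^ e * q) := by
    intro h hh
    obtain ⟨h1, q, rfl⟩ := Finset.mem_filter.1 hh
    refine Finset.mem_image.2 ⟨q, ?_, rfl⟩
    rw [mem_polysLT] at h1 ⊢
    refine lt_of_le_of_lt ?_ h1
    rw [mul_comm]
    exact degree_le_mul_left q (pow_ne_zero e X_ne_zero)
  refine (Finset.sum_le_sum_of_subset_of_nonneg hsub fun h _ _ => rp_nonneg p h).trans ?_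
  rw [Finset.sum_image fun a _ b _ h => mul_left_cancel₀ (pow_ne_zero e X_ne_zero) h]
  simp_rw [rp_X_pow_mul]
  rw [← Finset.sum_div, sum_rp]

/-! ### Averaging over the search set -/

open Classical in
/-- The search set for the modulus `x^m`, as a finite set. -/
def searchFinset (m w : ℕ) : Finset (ZMod p)[X] :=
  if w < m then (polysLT p (m - w)).filter (fun q => ¬ X ∣ q) else {1}

lemma isCoprime_X_pow_iff {m : ℕ} (hm : 1 ≤ m) (q : (ZMod p)[X]) :
    IsCoprime q (X ^ m) ↔ ¬ X ∣ q := by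
  rw [IsCoprime.pow_right_iff (by omega), isCoprime_comm, irreducible_X.coprime_iff_not_dvd]

lemma mem_searchFinset {m : ℕ} (hm : 1 ≤ m) (w : ℕ) (q : (ZMod p)[X]) :
    q ∈ searchFinset p m w ↔ q ∈ searchSet p m w (X ^ m) := by
  unfold searchFinset searchSet
  split_ifs
  · simp [isCoprime_X_pow_iff p hm]
  · simp

/-- The injection `q ↦ q + 1` sends multiples of `x` to non-multiples, so the latter are at least
half. -/
lemma pow_le_two_mul_card_searchFinset {m w : ℕ} (hw : w < m) :
    p ^ (m - w) ≤ 2 * (searchFinset p m w).card := by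
  classical
  rw [searchFinset, if_pos hw, ← card_polysLT p (m - w),
    ← Finset.card_filter_add_card_filter_not (s := polysLT p (m - w)) (fun q => X ∣ q)]
  have h : ((polysLT p (m - w)).filter (fun q => X ∣ q)).card
      ≤ ((polysLT p (m - w)).filter (fun q => ¬ X ∣ q)).card := by
    refine Finset.card_le_card_of_injOn (fun q => q + 1) ?_ (add_left_injective 1).injOn
    intro q hq
    simp only [Finset.coe_filter, mem_polysLT, Set.mem_ofPred_eq] at hq ⊢
    refine ⟨lt_of_le_of_lt (degree_add_le _ _) (max_lt hq.1 ?_), fun h => ?_⟩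
    · rw [degree_one]
      exact_mod_cast Nat.sub_pos_of_lt hw
    · exact irreducible_X.not_isUnit (isUnit_of_dvd_one ((dvd_add_right hq.2).1 h))
  omega

lemma card_searchFinset_pos (m w : ℕ) : 0 < (searchFinset p m w).card := by
  by_cases hw : w < m
  · have h1 := pow_le_two_mul_card_searchFinset p hw
    have h2 : 0 < p ^ (m - w) := pow_pos (Nat.pos_of_ne_zero (NeZero.ne p)) _
    omega
  · simp [searchFinset, hw]

/-- The lowest `n - e` coefficients agree throughout `S`, so the top `e` determine a member. -/
lemma card_le_of_X_pow_dvd_sub {n e : ℕ} (he : e ≤ n) (S : Finset (ZMod p)[X])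
    (hS : ∀ q ∈ S, q ∈ polysLT p n) (hd : ∀ q ∈ S, ∀ q' ∈ S, X ^ (n - e) ∣ q - q') :
    S.card ≤ p ^ e := by
  have hcard : (Finset.univ : Finset (Fin e → ZMod p)).card = p ^ e := by simp [ZMod.card]
  rw [← hcard]
  refine Finset.card_le_card_of_injOn (fun q i => q.coeff (n - e + i)) (by simp) ?_
  intro q hq q' hq' h
  ext k
  by_cases hk : k < n - e
  · have := X_pow_dvd_iff.1 (hd q hq q' hq') k hk
    rwa [coeff_sub, sub_eq_zero] at this
  by_cases hkn : k < n
  · have := congrFun h ⟨k - (n - e), by omega⟩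
    simpa only [show n - e + (k - (n - e)) = k by omega] using this
  · rw [(degree_lt_iff_coeff_zero _ _).1 ((mem_polysLT p).1 (hS q hq)) k (by omega),
      (degree_lt_iff_coeff_zero _ _).1 ((mem_polysLT p).1 (hS q' hq')) k (by omega)]

lemma X_pow_dvd_of_dvd_mul {k : ℕ} {a q : (ZMod p)[X]} (hq : ¬ X ∣ q) (h : X ^ k ∣ a * q) :
    X ^ k ∣ a := by
  refine IsCoprime.dvd_of_dvd_mul_right ?_ h
  exact IsCoprime.pow_left (irreducible_X.coprime_iff_not_dvd.2 hq)

lemma X_pow_dvd_cancel {j k : ℕ} {a : (ZMod p)[X]} (hjk : j ≤ k) (h : X ^ k ∣ X ^ j * a) :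
    X ^ (k - j) ∣ a := by
  have : X ^ k = (X ^ j * X ^ (k - j) : (ZMod p)[X]) := by rw [← pow_add]; congr 1; omega
  rw [this] at h
  exact (mul_dvd_mul_iff_left (pow_ne_zero j X_ne_zero)).1 h

/-- If `x^(w+e)` is the exact power of `x` in `c`, a solution `b` of
`c + b x^w q ≡ 0 (mod x^m)` has exact power `x^e`. -/
lemma exists_eq_X_pow_mul_of_solution {m w e : ℕ} (hwe : w + e < m) {c₁ b q : (ZMod p)[X]}
    (hc₁ : ¬ X ∣ c₁) (hq : ¬ X ∣ q) (h : X ^ m ∣ X ^ (w + e) * c₁ + b * (X ^ w * q)) :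
    ∃ b₁, b = X ^ e * b₁ ∧ ¬ X ∣ b₁ := by
  have h1 : X ^ (w + e) ∣ X ^ w * (b * q) := by
    have := (dvd_add_right (dvd_mul_right (X ^ (w + e)) c₁)).1 ((pow_dvd_pow X hwe.le).trans h)
    rwa [mul_left_comm] at this
  have h2 : X ^ e ∣ b := by
    have := X_pow_dvd_cancel p (Nat.le_add_right w e) h1
    rw [Nat.add_sub_cancel_left] at this
    exact X_pow_dvd_of_dvd_mul p hq this
  obtain ⟨b₁, rfl⟩ := h2
  refine ⟨b₁, rfl, fun hb₁ => hc₁ ?_⟩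
  have h3 : X ^ m ∣ X ^ (w + e) * (c₁ + b₁ * q) := by
    convert h using 1
    ring
  have h4 : X ∣ c₁ + b₁ * q :=
    (dvd_pow_self X (by omega : m - (w + e) ≠ 0)).trans (X_pow_dvd_cancel p hwe.le h3)
  exact (dvd_add_left (hb₁.mul_right q)).1 h4

open Classical in
-- If some `q` is a solution then `b = x^e b₁` with `b₁` prime to `x`, and cancelling `x^{w+e} b₁`
-- fixes `q` modulo `x^{m-w-e}`.
lemma card_solutions_le {m w e : ℕ} (hwe : w + e < m) {c₁ : (ZMod p)[X]} (hc₁ : ¬ X ∣ c₁)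
    (b : (ZMod p)[X]) :
    ((searchFinset p m w).filter
        (fun q => X ^ m ∣ X ^ (w + e) * c₁ + b * (X ^ w * q))).card
      ≤ if X ^ e ∣ b then p ^ e else 0 := by
  set S := (searchFinset p m w).filter (fun q => X ^ m ∣ X ^ (w + e) * c₁ + b * (X ^ w * q)) with hS
  have hmem : ∀ q ∈ S, (q ∈ polysLT p (m - w) ∧ ¬ X ∣ q) ∧
      X ^ m ∣ X ^ (w + e) * c₁ + b * (X ^ w * q) := by
    intro q hq
    rw [hS, Finset.mem_filter, searchFinset, if_pos (by omega), Finset.mem_filter] at hq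
    exact hq
  rcases S.eq_empty_or_nonempty with hE | ⟨q₀, hq₀⟩
  · rw [hE]; simp
  obtain ⟨b₁, rfl, hb₁⟩ := exists_eq_X_pow_mul_of_solution p hwe hc₁ (hmem q₀ hq₀).1.2 (hmem q₀ hq₀).2
  rw [if_pos (dvd_mul_right _ _)]
  refine card_le_of_X_pow_dvd_sub p (by omega : e ≤ m - w) S (fun q hq => (hmem q hq).1.1) ?_
  intro q hq q' hq'
  have h1 := dvd_sub (hmem q hq).2 (hmem q' hq').2
  have h2 : X ^ m ∣ X ^ (w + e) * ((q - q') * b₁) := by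
    convert h1 using 1
    ring
  have h3 := X_pow_dvd_of_dvd_mul p hb₁ (X_pow_dvd_cancel p hwe.le h2)
  rwa [Nat.sub_sub]

open Classical in
/-- The average over the search set of `∑_b r_p(b)`, the sum being over the solutions of
`c + b x^w q ≡ 0 (mod x^m)`. -/
lemma sum_searchFinset_sum_rp_le {m : ℕ} (w : ℕ) (c : (ZMod p)[X]) :
    ∑ q ∈ searchFinset p m w, ∑ b ∈ polysLT p m with X ^ m ∣ c + b * (X ^ w * q), rp p b
      ≤ (searchFinset p m w).card *
        ((p : ℝ) ^ min w m / (p : ℝ) ^ m * (2 * (m * (((p : ℝ) ^ 2 - 1) / (3 * p))))) := by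
  have hpp : 0 < (p : ℝ) := Nat.cast_pos.2 (Nat.pos_of_ne_zero (NeZero.ne p))
  set T : ℝ := m * (((p : ℝ) ^ 2 - 1) / (3 * p)) with hT
  have hT0 : 0 ≤ T := by
    rw [hT, ← sum_rp]
    exact Finset.sum_nonneg fun h _ => rp_nonneg p h
  by_cases hw : w < m
  swap
  -- For `w ≥ m` the ratio is `1` and the unrestricted sum of `rp` suffices.
  · have h1 : (p : ℝ) ^ min w m / (p : ℝ) ^ m = 1 := by
      rw [min_eq_right (not_lt.1 hw)]
      exact div_self (pow_pos hpp m).ne'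
    rw [h1, one_mul, ← nsmul_eq_mul, ← Finset.sum_const]
    refine Finset.sum_le_sum fun q _ => ?_
    refine (Finset.sum_le_sum_of_subset_of_nonneg (Finset.filter_subset _ _)
      fun b _ _ => rp_nonneg p b).trans ?_
    rw [sum_rp, ← hT]
    linarith
  have hratio : (p : ℝ) ^ min w m / (p : ℝ) ^ m = 1 / (p : ℝ) ^ (m - w) := by
    rw [min_eq_left hw.le, div_eq_div_iff (pow_pos hpp _).ne' (pow_pos hpp _).ne', ← pow_add, one_mul]
    congr 1
    omega
  rw [hratio]
  -- If `x^m ∣ c`, solutions `b` are multiples of `x^{m-w}`. Otherwise let `x^{e'}` exactly divide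
  -- `c`: there is no solution when `e' < w`, and for `e' = w + e` one counts the pairs `(q, b)` by
  -- `b`.
  by_cases hc : X ^ m ∣ c
  · rw [← nsmul_eq_mul, ← Finset.sum_const]
    refine Finset.sum_le_sum fun q hq => ?_
    rw [searchFinset, if_pos hw, Finset.mem_filter] at hq
    have hsub : (polysLT p m).filter (fun b => X ^ m ∣ c + b * (X ^ w * q))
        ⊆ (polysLT p m).filter (fun b => X ^ (m - w) ∣ b) := by
      intro b hb
      rw [Finset.mem_filter] at hb ⊢
      refine ⟨hb.1, X_pow_dvd_of_dvd_mul p hq.2 (X_pow_dvd_cancel p hw.le ?_)⟩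
      rw [mul_left_comm]
      exact (dvd_add_right hc).1 hb.2
    refine (Finset.sum_le_sum_of_subset_of_nonneg hsub fun b _ _ => rp_nonneg p b).trans ?_
    refine (sum_rp_X_pow_dvd_le p m (m - w)).trans ?_
    rw [← hT, one_div_mul_eq_div]
    exact div_le_div_of_nonneg_right (by linarith) (pow_pos hpp _).le
  · have hc0 : c ≠ 0 := by rintro rfl; exact hc (dvd_zero _)
    obtain ⟨e', c₁, rfl, hc₁⟩ : ∃ e' c₁, c = X ^ e' * c₁ ∧ ¬ X ∣ c₁ := by
      obtain ⟨c₁, h1, h2⟩ := exists_eq_pow_rootMultiplicity_mul_and_not_dvd c hc0 0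
      rw [C_0, sub_zero] at h1 h2
      exact ⟨_, c₁, h1, h2⟩
    have he'm : e' < m := by
      by_contra h
      exact hc ((pow_dvd_pow X (not_lt.1 h)).mul_right c₁)
    by_cases hwe : w ≤ e'
    swap
    · have hzero : ∀ q b : (ZMod p)[X], ¬ X ^ m ∣ X ^ e' * c₁ + b * (X ^ w * q) := by
        intro q b h
        have h1 : X ^ (e' + 1) ∣ b * (X ^ w * q) :=
          ((pow_dvd_pow X (by omega : e' + 1 ≤ w)).mul_right q).mul_left b
        have h2 := (dvd_add_left h1).1 ((pow_dvd_pow X (by omega : e' + 1 ≤ m)).trans h)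
        have h3 := X_pow_dvd_cancel p (Nat.le_succ e') h2
        rw [Nat.succ_sub (le_refl e'), Nat.sub_self, pow_one] at h3
        exact hc₁ h3
      simp only [hzero, Finset.filter_false, Finset.sum_empty, Finset.sum_const_zero]
      positivity
    obtain ⟨e, rfl⟩ := Nat.exists_eq_add_of_le hwe
    simp_rw [Finset.sum_filter]
    rw [Finset.sum_comm]
    have h1 : ∀ b ∈ polysLT p m, ∑ q ∈ searchFinset p m w,
        (if X ^ m ∣ X ^ (w + e) * c₁ + b * (X ^ w * q) then rp p b else 0)
          ≤ if X ^ e ∣ b then (p : ℝ) ^ e * rp p b else 0 := by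
      intro b _
      rw [← Finset.sum_filter, Finset.sum_const, nsmul_eq_mul]
      have h2 : (((searchFinset p m w).filter
          (fun q => X ^ m ∣ X ^ (w + e) * c₁ + b * (X ^ w * q))).card : ℝ)
          ≤ ((if X ^ e ∣ b then p ^ e else 0 : ℕ) : ℝ) :=
        Nat.cast_le.2 (card_solutions_le p he'm hc₁ b)
      refine (mul_le_mul_of_nonneg_right h2 (rp_nonneg p b)).trans (le_of_eq ?_)
      split_ifs <;> simp
    refine (Finset.sum_le_sum h1).trans ?_
    rw [← Finset.sum_filter, ← Finset.mul_sum]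
    -- The `p^e` choices of `q` cancel the saving `p^{-e}` from `x^e ∣ b`, leaving `T` whatever `e`
    -- is; the size of the search set absorbs it.
    refine (mul_le_mul_of_nonneg_left (sum_rp_X_pow_dvd_le p m e) (pow_pos hpp e).le).trans ?_
    rw [← hT, mul_div_cancel₀ _ (pow_pos hpp e).ne', one_div_mul_eq_div, ← mul_div_assoc,
      le_div_iff₀ (pow_pos hpp _)]
    have h3 : (p : ℝ) ^ (m - w) ≤ 2 * (searchFinset p m w).card := by
      exact_mod_cast pow_le_two_mul_card_searchFinset p hw
    nlinarith [mul_le_mul_of_nonneg_right h3 hT0]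

/-! ### The component-by-component bound -/

lemma sum_rpWeighted (m : ℕ) (γ : ℝ) :
    ∑ v : Fin m → ZMod p, rpWeighted p (polyOf p v) γ
      = 1 + γ + γ * (m * (((p : ℝ) ^ 2 - 1) / (3 * p))) := by
  rw [← sum_rp, sum_polysLT, Finset.mul_sum]
  have h : ∀ v : Fin m → ZMod p, rpWeighted p (polyOf p v) γ
      = (if v = 0 then 1 + γ else 0) + γ * rp p (polyOf p v) := by
    intro v
    by_cases hv : v = 0
    · simp [hv, rpWeighted, rp_zero]
    · simp [hv, rpWeighted, polyOf_eq_zero_iff]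
  simp_rw [h, Finset.sum_add_distrib]
  simp

lemma sum_prod_rpWeighted (m : ℕ) (γ : ℕ → ℝ) (d : ℕ) :
    ∑ h : Fin d → Fin m → ZMod p, ∏ i, rpWeighted p (polyOf p (h i)) (γ i)
      = ∏ i : Fin d, (1 + γ i + γ i * (m * (((p : ℝ) ^ 2 - 1) / (3 * p)))) := by
  rw [← Fintype.prod_sum (fun (i : Fin d) (v : Fin m → ZMod p) => rpWeighted p (polyOf p v) (γ i))]
  simp_rw [sum_rpWeighted]

open Classical in
-- Split by the last frequency `b`. The terms with `b = 0` give the first summand; those with `b ≠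
-- 0` give the second, where `h = 0` is now allowed because the whole frequency is nonzero anyway.
lemma figureR_snoc (m : ℕ) (γ : ℕ → ℝ) {d : ℕ} (G : Fin d → (ZMod p)[X]) (y f : (ZMod p)[X]) :
    figureR p m γ (Fin.snoc G y : Fin (d + 1) → (ZMod p)[X]) f
      = (1 + γ d) * figureR p m γ G f
        + γ d * ∑ h : Fin d → Fin m → ZMod p, (∏ i, rpWeighted p (polyOf p (h i)) (γ i)) *
          ∑ b ∈ polysLT p m with f ∣ ∑ i, polyOf p (h i) * G i + b * y, rp p b := by
  rw [figureR_eq_sum_vec, figureR_eq_sum_vec, Finset.sum_filter, Finset.sum_filter, sum_snoc,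
    Finset.sum_comm, Finset.mul_sum, Finset.mul_sum, ← Finset.sum_add_distrib]
  refine Finset.sum_congr rfl fun h _ => ?_
  rw [Finset.sum_filter, sum_polysLT]
  have hb : ∀ b : Fin m → ZMod p,
      (if (Fin.snoc h b : Fin (d + 1) → Fin m → ZMod p) ≠ 0 ∧
          f ∣ ∑ i, polyOf p ((Fin.snoc h b : Fin (d + 1) → Fin m → ZMod p) i) *
            (Fin.snoc G y : Fin (d + 1) → (ZMod p)[X]) i
        then ∏ i, rpWeighted p (polyOf p ((Fin.snoc h b : Fin (d + 1) → Fin m → ZMod p) i)) (γ i)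
        else 0)
      = (if b = 0 then (1 + γ d) * (if h ≠ 0 ∧ f ∣ ∑ i, polyOf p (h i) * G i
          then ∏ i, rpWeighted p (polyOf p (h i)) (γ i) else 0) else 0)
        + γ d * ((∏ i, rpWeighted p (polyOf p (h i)) (γ i)) *
          (if f ∣ ∑ i, polyOf p (h i) * G i + polyOf p b * y then rp p (polyOf p b) else 0)) := by
    intro b
    simp only [Fin.sum_univ_castSucc, Fin.prod_univ_castSucc, Fin.snoc_castSucc, Fin.snoc_last,
      Fin.val_castSucc, Fin.val_last]
    by_cases hb0 : b = 0
    · subst hb0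
      have hne : (Fin.snoc h (0 : Fin m → ZMod p) : Fin (d + 1) → Fin m → ZMod p) ≠ 0 ↔ h ≠ 0 := by
        refine not_congr ⟨fun h0 => ?_, fun h0 => ?_⟩
        · funext i
          have := congrFun h0 i.castSucc
          rwa [Fin.snoc_castSucc] at this
        · subst h0
          funext i
          refine Fin.lastCases ?_ (fun j => ?_) i <;> simp
      simp only [hne, polyOf_zero, zero_mul, add_zero, rp_zero, ite_self, mul_zero, if_true]
      split_ifs
      · simp [rpWeighted, mul_comm]
      · simp
    · have hne : (Fin.snoc h b : Fin (d + 1) → Fin m → ZMod p) ≠ 0 := by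
        intro h0
        have := congrFun h0 (Fin.last d)
        rw [Fin.snoc_last] at this
        exact hb0 this
      have hw : rpWeighted p (polyOf p b) (γ d) = γ d * rp p (polyOf p b) := by
        rw [rpWeighted, if_neg (fun h' => hb0 ((polyOf_eq_zero_iff p b).1 h'))]
      simp only [hne, ne_eq, not_false_eq_true, true_and, hb0, if_false, zero_add, hw]
      split_ifs
      · ring
      · simp
  simp_rw [hb]
  rw [Finset.sum_add_distrib, ← Finset.mul_sum, ← Finset.mul_sum]
  simp

/-- A minimizer over the search set is at most the average. -/
lemma figureR_snoc_le_of_minimal (m : ℕ) (γ : ℕ → ℝ) (hγ : ∀ j, 0 ≤ γ j) {d : ℕ}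
    (G : Fin d → (ZMod p)[X]) (w : ℕ) (R : ℝ)
    (hR : ∀ q ∈ searchFinset p m w,
      R ≤ figureR p m γ (Fin.snoc G (X ^ w * q) : Fin (d + 1) → (ZMod p)[X]) (X ^ m)) :
    R ≤ (1 + γ d) * figureR p m γ G (X ^ m)
      + γ d * ((∏ i : Fin d, (1 + γ i + γ i * (m * (((p : ℝ) ^ 2 - 1) / (3 * p))))) *
        ((p : ℝ) ^ min w m / (p : ℝ) ^ m * (2 * (m * (((p : ℝ) ^ 2 - 1) / (3 * p)))))) := by
  classical
  have hcard : (0 : ℝ) < (searchFinset p m w).card := Nat.cast_pos.2 (card_searchFinset_pos p m w)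
  refine le_of_mul_le_mul_left ?_ hcard
  rw [← nsmul_eq_mul, ← Finset.sum_const]
  refine (Finset.sum_le_sum hR).trans ?_
  simp_rw [figureR_snoc]
  rw [Finset.sum_add_distrib, Finset.sum_const, nsmul_eq_mul, mul_add, ← Finset.mul_sum,
    Finset.sum_comm, ← sum_prod_rpWeighted, mul_left_comm _ (γ d), Finset.sum_mul,
    Finset.mul_sum _ _ ((searchFinset p m w).card : ℝ)]
  refine add_le_add le_rfl (mul_le_mul_of_nonneg_left ?_ (hγ d))
  refine Finset.sum_le_sum fun h _ => ?_
  rw [← Finset.mul_sum, mul_left_comm]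
  exact mul_le_mul_of_nonneg_left (sum_searchFinset_sum_rp_le p w _)
    (Finset.prod_nonneg fun i _ => rpWeighted_nonneg p (hγ i) _)

/-- No nonzero polynomial of degree `< m` is divisible by `x^m`, so the sum is empty. -/
lemma figureR_one_eq_zero (m : ℕ) (γ : ℕ → ℝ) (G : Fin 1 → (ZMod p)[X]) (hG : G 0 = 1) :
    figureR p m γ G (X ^ m) = 0 := by
  classical
  unfold figureR
  refine Finset.sum_eq_zero fun h hh => ?_
  simp only [Finset.mem_filter, Fintype.mem_piFinset, mem_polysLT, Fin.sum_univ_one, hG,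
    mul_one] at hh
  exfalso
  refine hh.2.1 (funext fun i => ?_)
  rw [Subsingleton.elim i 0]
  refine eq_zero_of_dvd_of_degree_lt hh.2.2 ?_
  rw [degree_X_pow]
  exact hh.1 0

lemma figureR_take_le {m s : ℕ} (hm : 1 ≤ m) (γ : ℕ → ℝ) (hγ : ∀ j, 0 ≤ γ j) (w : ℕ → ℕ)
    (hw : w 0 = 0) (g : Fin s → (ZMod p)[X]) (hg : IsReducedCBC p m (X ^ m) w γ g)
    (d : ℕ) (hd1 : 1 ≤ d) (hd : d ≤ s) :
    figureR p m γ (Fin.take d hd (shiftedVector p w g)) (X ^ m)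
      ≤ 1 / (p : ℝ) ^ m * ∏ i : Fin d, (1 + γ i +
          γ i * 2 * (p : ℝ) ^ min (w i) m * m * (((p : ℝ) ^ 2 - 1) / (3 * p))) := by
  have hpp : 0 < (p : ℝ) := Nat.cast_pos.2 (Nat.pos_of_ne_zero (NeZero.ne p))
  have hp1 : 1 ≤ (p : ℝ) := by exact_mod_cast Nat.pos_of_ne_zero (NeZero.ne p)
  have hT0 : 0 ≤ ((p : ℝ) ^ 2 - 1) / (3 * p) :=
    div_nonneg (by nlinarith) (by positivity)
  set T : ℝ := ((p : ℝ) ^ 2 - 1) / (3 * p)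
  have hfac : ∀ i : ℕ, 0 ≤ 1 + γ i + γ i * 2 * (p : ℝ) ^ min (w i) m * m * T := by
    intro i
    have := hγ i
    positivity
  induction d, hd1 using Nat.le_induction with
  | base =>
    rw [figureR_one_eq_zero]
    · exact mul_nonneg (by positivity) (Finset.prod_nonneg fun i _ => hfac i)
    · simp only [Fin.take, shiftedVector, Fin.val_castLE, Fin.val_zero, hw, pow_zero, one_mul]
      exact hg.first_eq_one _ rfl
  | succ d hd1 ih =>
    have hds : d < s := hd
    have ih' := ih hds.le
    have hstep := figureR_snoc_le_of_minimal p m γ hγ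
      (Fin.take d hds.le (shiftedVector p w g)) (w d)
      (figureR p m γ (Fin.take (d + 1) hd (shiftedVector p w g)) (X ^ m)) (by
        intro q hq
        have h1 := hg.minimal d hds hd1 q ((mem_searchFinset p hm (w d) q).1 hq)
        refine h1.trans (le_of_eq ?_)
        congr 1
        rw [Fin.take_succ_eq_snoc d hds]
        congr 1
        · funext i
          simp only [Fin.take, shiftedVector, Fin.val_castLE]
          rw [Function.update_of_ne]
          intro h
          have := congrArg Fin.val h
          simp at this
          have := i.isLt
          omega
        · simp [shiftedVector])
    refine hstep.trans ?_
    set B := ∏ i : Fin d, (1 + γ i + γ i * 2 * (p : ℝ) ^ min (w i) m * m * T) with hB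
    -- Enlarging these factors to those of the target (`1 ≤ 2 p^{min(w,m)}`) lets both terms of the
    -- recursion share `B / p^m`; their multipliers add up to the next factor.
    have hle : ∏ i : Fin d, (1 + γ i + γ i * (m * T)) ≤ B := by
      refine Finset.prod_le_prod (fun i _ => ?_) (fun i _ => ?_)
      · have := hγ i
        positivity
      · have h1 : (1 : ℝ) ≤ (p : ℝ) ^ min (w i) m := one_le_pow₀ hp1
        have h2 : 0 ≤ γ i * (m * T) := by have := hγ i; positivity
        nlinarith
    rw [Fin.prod_univ_castSucc]
    simp only [Fin.val_castSucc, Fin.val_last]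
    rw [← hB]
    have h1 := mul_le_mul_of_nonneg_left ih' (by have := hγ d; linarith : (0 : ℝ) ≤ 1 + γ d)
    have h2 : γ d * ((∏ i : Fin d, (1 + γ i + γ i * (m * T))) *
        ((p : ℝ) ^ min (w d) m / (p : ℝ) ^ m * (2 * (m * T))))
        ≤ γ d * (B * ((p : ℝ) ^ min (w d) m / (p : ℝ) ^ m * (2 * (m * T)))) :=
      mul_le_mul_of_nonneg_left (mul_le_mul_of_nonneg_right hle (by positivity)) (hγ d)
    refine (add_le_add h1 h2).trans (le_of_eq ?_)
    ring

end

end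

end PolyLattice

theorem mainTheorem3 (p : ℕ) [Fact p.Prime] (m s : ℕ) (hm : 1 ≤ m) (hs : 1 ≤ s)
    (γ : ℕ → ℝ) (hγ_pos : ∀ j, 0 < γ j) (hγ_le : ∀ j, γ j ≤ 1) (hγ_anti : Antitone γ)
    (w : ℕ → ℕ) (hw_zero : w 0 = 0) (hw_mono : Monotone w)
    (g : Fin s → Polynomial (ZMod p))
    (hg : PolyLattice.IsReducedCBC p m (Polynomial.X ^ m) w γ g) :
    PolyLattice.weightedStarDiscrepancy (PolyLattice.productWeight γ)
        (PolyLattice.latticePoints p m (PolyLattice.shiftedVector p w g) (Polynomial.X ^ m)) ≤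
      (∑ u : Finset (Fin s) with u.Nonempty,
          PolyLattice.productWeight γ u * (1 - (1 - 1 / (p : ℝ) ^ m) ^ u.card)) +
        1 / (p : ℝ) ^ m *
          ∏ i : Fin s, (1 + γ i +
            γ i * 2 * (p : ℝ) ^ min (w i) m * m * (((p : ℝ) ^ 2 - 1) / (3 * p))) := by
  have hγ : ∀ j, 0 ≤ γ j := fun j => (hγ_pos j).le
  have hp1 : 1 ≤ (p : ℝ) ^ m := by
    exact_mod_cast Nat.one_le_pow _ _ (Nat.pos_of_ne_zero (NeZero.ne p))
  have hq0 : 0 ≤ 1 - 1 / (p : ℝ) ^ m := sub_nonneg.2 ((div_le_one (by positivity)).2 hp1)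
  have hq1 : 1 - 1 / (p : ℝ) ^ m ≤ 1 := sub_le_self _ (by positivity)
  have hfig := PolyLattice.figureR_take_le p hm γ hγ w hw_zero g hg s hs le_rfl
  rw [Fin.take_eq_self] at hfig
  refine csSup_le ?_ ?_
  -- `csSup_le` needs a nonempty set of values; `s ≥ 1` supplies a nonempty `u`.
  · exact ⟨_, fun _ => 1, by simp, {⟨0, hs⟩}, by simp, rfl⟩
  · rintro v ⟨t, ht, u, hu, rfl⟩
    refine (PolyLattice.weight_mul_localDiscrepancy_le p m γ hγ _ u t ht).trans
      (add_le_add ?_ hfig)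
    refine Finset.single_le_sum
      (f := fun u : Finset (Fin s) =>
        PolyLattice.productWeight γ u * (1 - (1 - 1 / (p : ℝ) ^ m) ^ u.card))
      (fun u _ => mul_nonneg (Finset.prod_nonneg fun j _ => hγ j) ?_) (by simpa using hu)
    exact sub_nonneg.2 (pow_le_one₀ hq0 hq1)
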